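/- Let $\mathscr A_2$ be the mod 2 Steenrod algebra, acting as usual on $P^{\otimes 5}=\mathbb F_2[x_1,\dots,x_5]$ with $|x_i|=1$; that is, $Sq^0=\mathrm{id}$, $Sq^1x_i=x_i^2$, $Sq^kx_i=0$ for $k>1$, and the Cartan formula $Sq^k(fg)=\sum_{i+j=k}Sq^i(f)\,Sq^j(g)$ holds. Let $P^{\otimes 5}_n$ be the space of homogeneous polynomials of degree $n$, and call an element of $P^{\otimes 5}_n$ decomposable if it lies in $\sum_{i\ge 0,\ 2^i\le n}\mathrm{Im}\bigl(Sq^{2^i}:P^{\otimes 5}_{n-2^i}\to P^{\otimes 5}_n\bigr)$. For a monomial $X=x_1^{u_1}\cdots x_5^{u_5}$ let $\omega(X)=(\omega_1(X),\omega_2(X),\dots)$, where $\omega_m(X)$ is the number of indices $j$ for which the coefficient of $2^{m-1}$ in the binary expansion of $u_j$ is $1$. For monomials $X$ and $Y=x_1^{v_1}\cdots x_5^{v_5}$ of the same degree write $X<Y$ if $\omega(X)<\omega(Y)$, or $\omega(X)=\omega(Y)$ and $(u_1,\dots,u_5)<(v_1,\dots,v_5)$, both in the left lexicographic order. A monomial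 $X$ of degree $n$ is inadmissible if there are monomials $Y_1,\dots,Y_k$ ($k\ge 0$) of degree $n$ with $Y_j<X$ for all $j$ such that $X-\sum_{j}Y_j$ is decomposable; otherwise $X$ is admissible. Then there are exactly $866$ admissible monomials of degree $31$ in $P^{\otimes 5}$. Moreover, the degree $31$ part $Q^{\otimes 5}_{31}=(\mathbb F_2\otimes_{\mathscr A_2}P^{\otimes 5})_{31}$ of the $\mathbb F_2$-vector space of $\mathscr A_2$-indecomposables has dimension $866$. -/

import Mathlib

open scoped TensorProduct

noncomputable section

namespace HitProblem

/-- The polynomial algebra `P^{⊗t} = 𝔽₂[x₁, …, x_t]`; the variables are indexed by `Fin t`. -/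
abbrev P (t : ℕ) : Type := MvPolynomial (Fin t) (ZMod 2)

/-- The total Steenrod square, with a formal variable `T` keeping track of the degree: the algebra
homomorphism `P^{⊗t} → P^{⊗t}[T]` with `x_i ↦ x_i + x_i² T`. -/
def totalSq (t : ℕ) : P t →ₐ[ZMod 2] Polynomial (P t) :=
  MvPolynomial.aeval fun i =>
    Polynomial.C (MvPolynomial.X i) + Polynomial.C (MvPolynomial.X i ^ 2) * Polynomial.X

/-- The Steenrod square `Sq^k` on `P^{⊗t}`: the coefficient of `T^k` in the total square. It is the
action given by `Sq^0 = id`, `Sq^1 x_i = x_i²`, `Sq^k x_i = 0` for `k > 1` and the Cartan formula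
(`sq_zero`, `sq_X_one`, `sq_X_of_one_lt`, `sq_mul` below). -/
def Sq (t k : ℕ) : P t →ₗ[ZMod 2] P t :=
  ((Polynomial.lcoeff (P t) k).restrictScalars (ZMod 2)).comp (totalSq t).toLinearMap

theorem sq_apply (t k : ℕ) (f : P t) : Sq t k f = (totalSq t f).coeff k := rfl

theorem totalSq_X (t : ℕ) (i : Fin t) : totalSq t (MvPolynomial.X i) =
    Polynomial.C (MvPolynomial.X i) + Polynomial.C (MvPolynomial.X i ^ 2) * Polynomial.X := by
  simp [totalSq]

/-- The Cartan formula. -/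
theorem sq_mul (t k : ℕ) (f g : P t) :
    Sq t k (f * g) = ∑ p ∈ Finset.HasAntidiagonal.antidiagonal k, Sq t p.1 f * Sq t p.2 g := by
  simp [sq_apply, Polynomial.coeff_mul]

theorem sq_zero (t : ℕ) (f : P t) : Sq t 0 f = f := by
  have h : (Polynomial.constantCoeff.comp (totalSq t).toRingHom) = RingHom.id (P t) := by
    apply MvPolynomial.ringHom_ext
    · intro r
      simp [totalSq, Polynomial.algebraMap_apply]
    · intro i
      simp [totalSq_X]
  have := congrArg (fun φ => φ f) h
  simpa [sq_apply] using this

theorem sq_X_one (t : ℕ) (i : Fin t) : Sq t 1 (MvPolynomial.X i) = MvPolynomial.X i ^ 2 := by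
  rw [sq_apply, totalSq_X, Polynomial.coeff_add, Polynomial.coeff_C_mul]
  simp

theorem sq_X_of_one_lt (t k : ℕ) (i : Fin t) (hk : 1 < k) : Sq t k (MvPolynomial.X i) = 0 := by
  rw [sq_apply, totalSq_X, Polynomial.coeff_add, Polynomial.coeff_C_mul,
    Polynomial.coeff_X_of_ne_one (by omega), Polynomial.coeff_C_of_ne_zero (by omega)]
  simp

theorem sq_C (t k : ℕ) (hk : 0 < k) (r : ZMod 2) : Sq t k (MvPolynomial.C r) = 0 := by
  rw [sq_apply, totalSq, MvPolynomial.aeval_C, Polynomial.algebraMap_apply,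
    Polynomial.coeff_C_of_ne_zero (by omega)]

/-- Auxiliary: `Sq^n` for `n ∈ ℤ`, zero for `n < 0`. -/
def SqInt (t : ℕ) (n : ℤ) : P t →ₗ[ZMod 2] P t := if 0 ≤ n then Sq t n.toNat else 0

theorem sqInt_natCast (t n : ℕ) : SqInt t n = Sq t n := by simp [SqInt]

theorem sqInt_neg (t : ℕ) {n : ℤ} (h : n < 0) : SqInt t n = 0 := by
  simp [SqInt, not_le.mpr h]

theorem sqInt_X_mul (t : ℕ) (n : ℤ) (i : Fin t) (f : P t) :
    SqInt t n (MvPolynomial.X i * f) =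
      MvPolynomial.X i * SqInt t n f + MvPolynomial.X i ^ 2 * SqInt t (n - 1) f := by
  rcases lt_or_ge n 0 with h | h
  · simp [sqInt_neg t h, sqInt_neg t (show n - 1 < 0 by omega)]
  · lift n to ℕ using h
    cases n with
    | zero =>
      rw [sqInt_neg t (show ((0 : ℕ) : ℤ) - 1 < 0 by simp)]
      simp only [sqInt_natCast, sq_zero]; simp
    | succ n =>
      rw [show ((n + 1 : ℕ) : ℤ) - 1 = (n : ℤ) by push_cast; ring]
      simp only [sqInt_natCast, sq_apply, map_mul, totalSq_X, add_mul, Polynomial.coeff_add,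
        mul_assoc, Polynomial.coeff_C_mul, Polynomial.coeff_X_mul]

theorem sqInt_X_sq_mul (t : ℕ) (n : ℤ) (i : Fin t) (f : P t) :
    SqInt t n (MvPolynomial.X i ^ 2 * f) =
      MvPolynomial.X i ^ 2 * SqInt t n f + MvPolynomial.X i ^ 4 * SqInt t (n - 2) f := by
  have h2 : (2 : P t) = 0 := CharTwo.two_eq_zero
  rw [pow_two, mul_assoc, sqInt_X_mul, sqInt_X_mul, sqInt_X_mul,
    show n - 1 - 1 = n - 2 by ring]
  linear_combination (MvPolynomial.X i ^ 3 * SqInt t (n - 1) f) * h2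

/-- Auxiliary: the binomial coefficient of the Adem relation, zero for `2j > a`. -/
def ademCoeff (a : ℤ) (b j : ℕ) : ZMod 2 :=
  if 2 * (j : ℤ) ≤ a then ((b - 1 - j).choose (a - 2 * j).toNat : ZMod 2) else 0

theorem ademCoeff_of_lt {a : ℤ} {b j : ℕ} (h : a < 2 * j) : ademCoeff a b j = 0 := by
  rw [ademCoeff, if_neg (by omega)]

theorem ademCoeff_shift (a : ℤ) (b j : ℕ) :
    ademCoeff a (b + 1) (j + 1) = ademCoeff (a - 2) b j := by
  unfold ademCoeff
  by_cases h : 2 * ((j + 1 : ℕ) : ℤ) ≤ a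
  · rw [if_pos h, if_pos (by push_cast at h; omega),
      show b + 1 - 1 - (j + 1) = b - 1 - j by omega,
      show a - 2 * ((j + 1 : ℕ) : ℤ) = a - 2 - 2 * j by push_cast; ring]
  · rw [if_neg h, if_neg (by push_cast at h; omega)]

theorem ademCoeff_nat (n d j : ℕ) :
    ademCoeff (2 * j + n) (j + 1 + d) j = (d.choose n : ZMod 2) := by
  unfold ademCoeff
  rw [if_pos (by omega), show j + 1 + d - 1 - j = d by omega,
    show (2 * (j : ℤ) + n - 2 * j).toNat = n by omega]

/-- Pascal's rule modulo two. -/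
theorem ademCoeff_rec (a : ℤ) (b j : ℕ) (hj : j < b) :
    ademCoeff a (b + 1) j + ademCoeff a (b + 1) (j + 1) =
      ademCoeff (a - 1) (b + 1) j + ademCoeff a b j := by
  have h2 : (2 : ZMod 2) = 0 := rfl
  obtain ⟨d, rfl⟩ : ∃ d, b = j + 1 + d := ⟨b - (j + 1), by omega⟩
  rcases lt_or_ge a (2 * j) with h | h
  · rw [ademCoeff_of_lt h, ademCoeff_of_lt (by push_cast; omega), ademCoeff_of_lt (by omega),
      ademCoeff_of_lt h]
  · obtain ⟨n, rfl⟩ : ∃ n : ℕ, a = 2 * j + n := ⟨(a - 2 * j).toNat, by omega⟩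
    rw [ademCoeff_shift, show j + 1 + d + 1 = j + 1 + (d + 1) by ring, ademCoeff_nat,
      show j + 1 + d = j + 1 + d from rfl, ademCoeff_nat]
    rcases n with _ | _ | n
    · rw [ademCoeff_of_lt (by push_cast; omega), ademCoeff_of_lt (by push_cast; omega)]
      simp
    · rw [ademCoeff_of_lt (by push_cast; omega),
        show 2 * (j : ℤ) + ((0 + 1 : ℕ) : ℤ) - 1 = 2 * j + ((0 : ℕ) : ℤ) by push_cast; ring,
        ademCoeff_nat]
      simp [add_comm]
    · rw [show 2 * (j : ℤ) + ((n + 1 + 1 : ℕ) : ℤ) - 1 = 2 * j + ((n + 1 : ℕ) : ℤ) by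
          push_cast; ring,
        show 2 * (j : ℤ) + ((n + 1 + 1 : ℕ) : ℤ) - 2 = 2 * j + (n : ℤ) by push_cast; ring,
        ademCoeff_nat, ademCoeff_nat, Nat.choose_succ_succ d n, Nat.choose_succ_succ d (n + 1)]
      push_cast
      ring

/-- The middle step of the Adem relations, for the coefficient of `x²`. -/
theorem sqInt_adem_aux (t : ℕ) (p : P t) (a : ℤ) (b : ℕ) (hab : a < 2 * (b + 1 : ℕ))
    (ih : ∀ (a : ℤ) (b : ℕ), a < 2 * b → SqInt t a (SqInt t b p) =
      ∑ j ∈ Finset.range b, ademCoeff a b j • SqInt t (a + b - j) (SqInt t j p)) :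
    SqInt t (a - 1) (SqInt t (b + 1 : ℕ) p) + SqInt t a (SqInt t b p) =
      ∑ j ∈ Finset.range (b + 1), (ademCoeff a (b + 1) j + ademCoeff a (b + 1) (j + 1)) •
        SqInt t (a + b - j) (SqInt t j p) := by
  have h1 : SqInt t (a - 1) (SqInt t (b + 1 : ℕ) p) = ∑ j ∈ Finset.range (b + 1),
      ademCoeff (a - 1) (b + 1) j • SqInt t (a + b - j) (SqInt t j p) := by
    rw [ih _ _ (by omega)]
    refine Finset.sum_congr rfl fun j _ => ?_
    rw [show a - 1 + ((b + 1 : ℕ) : ℤ) - j = a + b - j by push_cast; ring]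
  rw [h1, Finset.sum_range_succ, Finset.sum_range_succ,
    ademCoeff_of_lt (show a < 2 * ((b + 1 : ℕ) : ℤ) from hab), add_zero]
  have hlast : SqInt t (a + b - b) (SqInt t b p) = SqInt t a (SqInt t b p) := by
    rw [show a + (b : ℤ) - b = a by ring]
  rw [hlast]
  have hrec : ∑ j ∈ Finset.range b, (ademCoeff a (b + 1) j + ademCoeff a (b + 1) (j + 1)) •
        SqInt t (a + b - j) (SqInt t j p) =
      ∑ j ∈ Finset.range b, ademCoeff (a - 1) (b + 1) j • SqInt t (a + b - j) (SqInt t j p) +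
      ∑ j ∈ Finset.range b, ademCoeff a b j • SqInt t (a + b - j) (SqInt t j p) := by
    rw [← Finset.sum_add_distrib]
    refine Finset.sum_congr rfl fun j hj => ?_
    rw [ademCoeff_rec a b j (Finset.mem_range.mp hj), add_smul]
  rw [hrec]
  rcases lt_or_ge a (2 * b) with h | h
  · rw [← ih a b h, ademCoeff_of_lt (show a - 1 < 2 * (b : ℤ) by omega), ademCoeff_of_lt h]
    module
  · have hz : ∑ j ∈ Finset.range b, ademCoeff a b j • SqInt t (a + b - j) (SqInt t j p) = 0 := by
      refine Finset.sum_eq_zero fun j hj => ?_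
      have hj := Finset.mem_range.mp hj
      rw [ademCoeff, if_pos (by omega), Nat.choose_eq_zero_of_lt (by omega)]
      simp
    rw [hz]
    have hc : ademCoeff (a - 1) (b + 1) b + 1 = ademCoeff a (b + 1) b := by
      have : a = 2 * b + ((0 : ℕ) : ℤ) ∨ a = 2 * b + ((1 : ℕ) : ℤ) := by push_cast; omega
      rcases this with rfl | rfl
      · have := ademCoeff_nat 0 0 b
        rw [add_zero] at this
        rw [this, ademCoeff_of_lt (by push_cast; omega)]
        simp
      · have h0 := ademCoeff_nat 0 0 b
        have h1 := ademCoeff_nat 1 0 b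
        rw [add_zero] at h0 h1
        rw [h1, show 2 * (b : ℤ) + ((1 : ℕ) : ℤ) - 1 = 2 * b + ((0 : ℕ) : ℤ) by push_cast; ring, h0]
        decide
    rw [← hc]
    module

/-- The Adem relations hold on `P^{⊗t}`. -/
theorem sqInt_adem (t : ℕ) (f : P t) : ∀ (a : ℤ) (b : ℕ), a < 2 * b →
    SqInt t a (SqInt t b f) =
      ∑ j ∈ Finset.range b, ademCoeff a b j • SqInt t (a + b - j) (SqInt t j f) := by
  induction f using MvPolynomial.induction_on with
  | C r =>
    intro a b hab
    rcases lt_or_ge a 0 with ha | ha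
    · rw [sqInt_neg t ha]
      refine (Finset.sum_eq_zero fun j _ => ?_).symm
      rw [ademCoeff_of_lt (by omega), zero_smul]
    rw [sqInt_natCast, sq_C t b (by omega), map_zero]
    refine (Finset.sum_eq_zero fun j _ => ?_).symm
    rcases Nat.eq_zero_or_pos j with rfl | hj
    · rw [sqInt_natCast, sq_zero, show a + (b : ℤ) - ((0 : ℕ) : ℤ) = (a.toNat + b : ℕ) by omega,
        sqInt_natCast, sq_C t _ (by omega), smul_zero]
    · rw [sqInt_natCast, sq_C t j hj, map_zero, smul_zero]
  | add p q hp hq =>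
    intro a b hab
    simp only [map_add, smul_add, Finset.sum_add_distrib, hp a b hab, hq a b hab]
  | mul_X p i ih =>
    intro a b hab
    rcases lt_or_ge a 0 with ha | ha
    · rw [sqInt_neg t ha]
      refine (Finset.sum_eq_zero fun j _ => ?_).symm
      rw [ademCoeff_of_lt (by omega), zero_smul]
    obtain ⟨b, rfl⟩ : ∃ c, b = c + 1 := ⟨b - 1, by omega⟩
    rw [mul_comm p]
    have expand : ∀ m n : ℤ, SqInt t m (SqInt t n (MvPolynomial.X i * p)) =
        MvPolynomial.X i * SqInt t m (SqInt t n p) +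
        MvPolynomial.X i ^ 2 * (SqInt t (m - 1) (SqInt t n p) + SqInt t m (SqInt t (n - 1) p)) +
        MvPolynomial.X i ^ 4 * SqInt t (m - 2) (SqInt t (n - 1) p) := by
      intro m n
      rw [sqInt_X_mul t n, map_add, sqInt_X_mul, sqInt_X_sq_mul]
      ring
    -- reindexing a sum in which `Sq^{j-1}` occurs
    have shift : ∀ m : ℤ, ∑ j ∈ Finset.range (b + 1), ademCoeff a (b + 1) j •
          SqInt t (m - j) (SqInt t (j - 1) p) =
        ∑ j ∈ Finset.range b, ademCoeff a (b + 1) (j + 1) •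
          SqInt t (m - 1 - j) (SqInt t j p) := by
      intro m
      rw [Finset.sum_range_succ', sqInt_neg t (show ((0 : ℕ) : ℤ) - 1 < 0 by simp)]
      simp only [LinearMap.zero_apply, map_zero, smul_zero, add_zero]
      refine Finset.sum_congr rfl fun j _ => ?_
      rw [show m - ((j + 1 : ℕ) : ℤ) = m - 1 - j by push_cast; ring,
        show ((j + 1 : ℕ) : ℤ) - 1 = j by push_cast; ring]
    simp only [expand, smul_add, Finset.sum_add_distrib, ← mul_smul_comm, ← Finset.mul_sum]
    rw [show ((b + 1 : ℕ) : ℤ) - 1 = b by push_cast; ring,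
      sqInt_adem_aux t p a b hab ih, ih a (b + 1) hab, shift,
      ih (a - 2) b (by push_cast at hab; omega)]
    have e2 : ∑ j ∈ Finset.range (b + 1), (ademCoeff a (b + 1) j + ademCoeff a (b + 1) (j + 1)) •
          SqInt t (a + b - j) (SqInt t j p) =
        ∑ j ∈ Finset.range (b + 1), ademCoeff a (b + 1) j •
          SqInt t (a + (b + 1 : ℕ) - j - 1) (SqInt t j p) +
        ∑ j ∈ Finset.range b, ademCoeff a (b + 1) (j + 1) •
          SqInt t (a + (b + 1 : ℕ) - 1 - j) (SqInt t j p) := by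
      simp only [add_smul, Finset.sum_add_distrib]
      congr 1
      · refine Finset.sum_congr rfl fun j _ => ?_
        rw [show a + ((b + 1 : ℕ) : ℤ) - j - 1 = a + b - j by push_cast; ring]
      · rw [Finset.sum_range_succ, ademCoeff_of_lt hab, zero_smul, add_zero]
        refine Finset.sum_congr rfl fun j _ => ?_
        rw [show a + ((b + 1 : ℕ) : ℤ) - 1 - j = a + b - j by push_cast; ring]
    have e4 : ∑ j ∈ Finset.range (b + 1), ademCoeff a (b + 1) j •
          SqInt t (a + (b + 1 : ℕ) - j - 2) (SqInt t (j - 1) p) =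
        ∑ j ∈ Finset.range b, ademCoeff (a - 2) b j • SqInt t (a - 2 + b - j) (SqInt t j p) := by
      have := shift (a + (b + 1 : ℕ) - 2)
      simp only [ademCoeff_shift] at this
      convert this using 2
      · rename_i j _
        rw [show a + ((b + 1 : ℕ) : ℤ) - 2 - j = a + (b + 1 : ℕ) - j - 2 by ring]
      · rename_i j _
        rw [show a - 2 + (b : ℤ) - j = a + (b + 1 : ℕ) - 2 - 1 - j by push_cast; ring]
    rw [e2, e4]

theorem sq_adem (t a b : ℕ) (hab : a < 2 * b) (f : P t) :
    Sq t a (Sq t b f) = ∑ j ∈ Finset.range (a / 2 + 1),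
      ((b - 1 - j).choose (a - 2 * j) : ZMod 2) • Sq t (a + b - j) (Sq t j f) := by
  have h := sqInt_adem t f a b (by omega)
  rw [sqInt_natCast, sqInt_natCast] at h
  rw [h, ← Finset.sum_subset (Finset.range_subset_range.mpr (show a / 2 + 1 ≤ b by omega))]
  · refine Finset.sum_congr rfl fun j hj => ?_
    have hj := Finset.mem_range.mp hj
    rw [ademCoeff, if_pos (by omega), show (a : ℤ) + b - j = (a + b - j : ℕ) by omega,
      sqInt_natCast, sqInt_natCast, show ((a : ℤ) - 2 * j).toNat = a - 2 * j by omega]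
  · intro j _ hj
    rw [Finset.mem_range] at hj
    rw [ademCoeff_of_lt (by omega), zero_smul]

/-- The defining relations of the Steenrod algebra among the free generators `Sq^k`, `k ≥ 0`:
`Sq^0 = 1` and the Adem relations
`Sq^a Sq^b = ∑_{0 ≤ j ≤ a/2} C(b-1-j, a-2j) Sq^{a+b-j} Sq^j` for `0 < a < 2b`. -/
inductive AdemRel : FreeAlgebra (ZMod 2) ℕ → FreeAlgebra (ZMod 2) ℕ → Prop
  | unit : AdemRel (FreeAlgebra.ι (ZMod 2) 0) 1
  | adem (a b : ℕ) (ha : 0 < a) (hab : a < 2 * b) :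
      AdemRel (FreeAlgebra.ι (ZMod 2) a * FreeAlgebra.ι (ZMod 2) b)
        (∑ j ∈ Finset.range (a / 2 + 1), ((b - 1 - j).choose (a - 2 * j) : ZMod 2) •
          (FreeAlgebra.ι (ZMod 2) (a + b - j) * FreeAlgebra.ι (ZMod 2) j))

/-- The mod 2 Steenrod algebra `𝒜₂`. -/
abbrev SteenrodAlgebra : Type := RingQuot AdemRel

/-- The action of the Steenrod algebra on `P^{⊗t}`. -/
def act (t : ℕ) : SteenrodAlgebra →ₐ[ZMod 2] Module.End (ZMod 2) (P t) :=
  RingQuot.liftAlgHom (ZMod 2) ⟨FreeAlgebra.lift (ZMod 2) (Sq t), by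
    intro x y h
    cases h with
    | unit =>
      refine LinearMap.ext fun f => ?_
      simp [sq_zero]
    | adem a b ha hab =>
      refine LinearMap.ext fun f => ?_
      simpa using sq_adem t a b hab f⟩

/-- The augmentation `𝒜₂ → 𝔽₂`, with `Sq^0 ↦ 1` and `Sq^k ↦ 0` for `k > 0`. -/
def augmentation : SteenrodAlgebra →ₐ[ZMod 2] ZMod 2 :=
  RingQuot.liftAlgHom (ZMod 2) ⟨FreeAlgebra.lift (ZMod 2) fun k => if k = 0 then 1 else 0, by
    intro x y h
    cases h with
    | unit => simp
    | adem a b ha hab =>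
      have h1 : ∀ j ∈ Finset.range (a / 2 + 1), a + b - j ≠ 0 := fun j hj => by
        have := Finset.mem_range.mp hj
        omega
      simp only [map_mul, map_sum, map_smul, FreeAlgebra.lift_ι_apply, if_neg ha.ne', zero_mul]
      exact (Finset.sum_eq_zero fun j hj => by rw [if_neg (h1 j hj), zero_mul, smul_zero]).symm⟩

/-- The subspace of `𝔽₂ ⊗ P^{⊗t}` (tensor product over `𝔽₂`) that is divided out in the tensor
product over `𝒜₂`; here `𝔽₂` is the right `𝒜₂`-module with `c · θ = c ε(θ)`. -/
def balancing (t : ℕ) : Submodule (ZMod 2) (ZMod 2 ⊗[ZMod 2] P t) :=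
  Submodule.span (ZMod 2) {z | ∃ (c : ZMod 2) (θ : SteenrodAlgebra) (f : P t),
    z = (c * augmentation θ) ⊗ₜ[ZMod 2] f - c ⊗ₜ[ZMod 2] act t θ f}

/-- `Q^{⊗t} = 𝔽₂ ⊗_{𝒜₂} P^{⊗t}`. -/
abbrev Q (t : ℕ) : Type := (ZMod 2 ⊗[ZMod 2] P t) ⧸ balancing t

/-- `Q^{⊗t}_n`, the degree `n` part of `Q^{⊗t}`: the classes of `1 ⊗ f` with `f` homogeneous of
degree `n`. -/
def Qdeg (t n : ℕ) : Submodule (ZMod 2) (Q t) :=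
  (MvPolynomial.homogeneousSubmodule (Fin t) (ZMod 2) n).map
    ((balancing t).mkQ.comp (TensorProduct.mk (ZMod 2) (ZMod 2) (P t) 1))

/-- The decomposable (hit) elements of degree `n`:
`∑_{i ≥ 0} Im (Sq^{2^i} : P^{⊗t}_{n - 2^i} → P^{⊗t}_n)`. -/
def hit (t n : ℕ) : Submodule (ZMod 2) (P t) :=
  ⨆ (i : ℕ) (_ : 2 ^ i ≤ n),
    (MvPolynomial.homogeneousSubmodule (Fin t) (ZMod 2) (n - 2 ^ i)).map (Sq t (2 ^ i))

/-- The weight vector of the monomial `x^u`: its `m`-th entry (counted from `m = 0`) is the number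
of exponents `u_i` whose `m`-th binary digit is `1`. -/
def weight {t : ℕ} (u : Fin t →₀ ℕ) : ℕ → ℕ := fun m => ∑ i, u i / 2 ^ m % 2

/-- The order on monomials of the same degree: left lexicographic in the weight vectors, and then
left lexicographic in the exponent vectors. -/
def MonomialLT {t : ℕ} (u v : Fin t →₀ ℕ) : Prop :=
  toLex (weight u) < toLex (weight v) ∨
    (weight u = weight v ∧ toLex (u : Fin t → ℕ) < toLex (v : Fin t → ℕ))

/-- The monomial `x^u` is inadmissible if it is congruent, modulo decomposable elements, to a sum
of smaller monomials of the same degree. Equal summands cancel in pairs over `𝔽₂`, so the summands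
form a finite set, possibly empty. -/
def Inadmissible {t : ℕ} (u : Fin t →₀ ℕ) : Prop :=
  ∃ S : Finset (Fin t →₀ ℕ), (∀ v ∈ S, v.degree = u.degree ∧ MonomialLT v u) ∧
    MvPolynomial.monomial u (1 : ZMod 2) - ∑ v ∈ S, MvPolynomial.monomial v (1 : ZMod 2) ∈
      hit t u.degree

/-- The admissible monomials of degree `n` in `P^{⊗t}`, given by their exponent vectors. -/
def admissibleMonomials (t n : ℕ) : Set (Fin t →₀ ℕ) :=
  {u | u.degree = n ∧ ¬ Inadmissible u}

end HitProblem

end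

/-!
Both numbers are the codimension of the space `hit 5 31` of decomposable elements in the space of
homogeneous polynomials of degree `31`. For the admissible monomials this is the usual echelon
argument: modulo `hit t n`, every monomial reduces to admissible ones by induction along
`MonomialLT`, and the largest monomial of a linear relation between admissible ones would be
inadmissible (`ncard_admissibleMonomials_add_finrank_hit`). For the indecomposables it holds
because the Adem relations express every `Sq^k` with `k > 0` through the squares `Sq^{2^i}`
(`finrank_Qdeg_add_finrank_hit`). As there are `52360` monomials of degree `31` in five variables,
it remains to show that `hit 5 31` has dimension `51494`.

This is the rank of an explicit matrix, but one with `52360` columns. It is split into small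
blocks by means of the action of the Singer cycle, a generator of the multiplicative group of the
field with `32` elements acting on its additive group. Over that field the Singer cycle is
diagonalized by a Moore matrix, and in the new variables `y_0, …, y_4` the total square is
`y_j ↦ y_j + y_{j-1}² T` (`exists_moore_matrix`, `finrank_hit_eq_cyc`). The coefficients of this
model lie in `𝔽₂` again, so that the dimension may be computed over `𝔽₂`, and now the operations
respect the grading by `ZMod 31` in which `y_j` has weight `2^j`: the space is a direct sum of
`31` blocks (`finrank_twistedHit_eq_sum`). The cyclic shift of the variables doubles weights, so
the dimension of a block depends only on the orbit of its weight under doubling, and seven blocks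
are left (`finrank_blockHit_two_mul`, `sum_eq_of_two_mul_invariant`).

The rank of each of them is found by Gaussian elimination over `𝔽₂` on rows stored as natural
numbers, a computation carried out by the kernel. The monomials of a block are turned into bit
positions by the substitution `y_j ↦ z^{c_j}` with suitable exponents `c_j`; it suffices that no
two monomials of a block get the same position, which is computed as well. The correctness of the
elimination is `eliminate_zero_eq_finrank`, that of the rows is `rowVec_sqRow` and
`span_rowVec_blockRows`. The seven ranks give `1664 + 5 * 9966 = 51494`.
-/

namespace HitProblem

/-! ### Twisted Steenrod squares and extension of scalars -/

section

open MvPolynomial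

section Twisted

variable (K : Type*) [Field K] {t : ℕ} (σ : Fin t → Fin t)

/-- The total square twisted by a map `σ` of the indices: the algebra homomorphism with
`x_i ↦ x_i + x_{σ i}² T`. For `σ = id` and `K = 𝔽₂` it is `totalSq`. -/
noncomputable def twistedTotalSq :
    MvPolynomial (Fin t) K →ₐ[K] Polynomial (MvPolynomial (Fin t) K) :=
  aeval fun i => Polynomial.C (X i) + Polynomial.C (X (σ i) ^ 2) * Polynomial.X

/-- The twisted square: the coefficient of `T^k` in the twisted total square. -/
noncomputable def twistedSq (k : ℕ) : MvPolynomial (Fin t) K →ₗ[K] MvPolynomial (Fin t) K :=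
  ((Polynomial.lcoeff (MvPolynomial (Fin t) K) k).restrictScalars K).comp
    (twistedTotalSq K σ).toLinearMap

theorem twistedSq_apply (k : ℕ) (f : MvPolynomial (Fin t) K) :
    twistedSq K σ k f = (twistedTotalSq K σ f).coeff k := rfl

/-- The elements of degree `n` which are hit by the twisted squares with exponents `2^i`. -/
noncomputable def twistedHit (n : ℕ) : Submodule K (MvPolynomial (Fin t) K) :=
  ⨆ (i : ℕ) (_ : 2 ^ i ≤ n),
    (homogeneousSubmodule (Fin t) K (n - 2 ^ i)).map (twistedSq K σ (2 ^ i))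

theorem hit_eq_twistedHit (t n : ℕ) : hit t n = twistedHit (ZMod 2) (id : Fin t → Fin t) n := rfl

theorem homogeneousSubmodule_eq_span (n : ℕ) : homogeneousSubmodule (Fin t) K n =
    Submodule.span K ((fun u => monomial u (1 : K)) '' {u | u.degree = n}) := by
  apply le_antisymm
  · intro f hf
    rw [← f.support_sum_monomial_coeff]
    refine Submodule.sum_mem _ fun u hu => ?_
    rw [show monomial u (coeff u f) = coeff u f • monomial u (1 : K) by simp [smul_monomial]]
    refine Submodule.smul_mem _ _ (Submodule.subset_span ⟨u, ?_, rfl⟩)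
    have := hf (mem_support_iff.mp hu)
    rw [Set.mem_ofPred_eq, Finsupp.degree_eq_weight_one]
    exact this
  · rw [Submodule.span_le]
    rintro _ ⟨u, hu, rfl⟩
    exact isHomogeneous_monomial _ hu

theorem twistedHit_eq_span (n : ℕ) : twistedHit K σ n =
    Submodule.span K {f | ∃ (i : ℕ) (v : Fin t →₀ ℕ), 2 ^ i ≤ n ∧ v.degree = n - 2 ^ i ∧
      f = twistedSq K σ (2 ^ i) (monomial v 1)} := by
  apply le_antisymm
  · refine iSup₂_le fun i hi => ?_
    rw [homogeneousSubmodule_eq_span, Submodule.map_span, Submodule.span_le]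
    rintro _ ⟨_, ⟨v, hv, rfl⟩, rfl⟩
    exact Submodule.subset_span ⟨i, v, hi, hv, rfl⟩
  · rw [Submodule.span_le]
    rintro _ ⟨i, v, hi, hv, rfl⟩
    exact Submodule.mem_iSup_of_mem i (Submodule.mem_iSup_of_mem hi
      ⟨_, isHomogeneous_monomial _ hv, rfl⟩)

variable {K σ}

theorem linearIndependent_map_algebraMap {F : Type*} [Field F] [Algebra F K] {ι τ : Type*}
    {b : ι → MvPolynomial τ F} (hb : LinearIndependent F b) :
    LinearIndependent K fun i => map (algebraMap F K) (b i) := by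
  rw [linearIndependent_iff'] at hb ⊢
  intro s c hc i hi
  -- a linear form `κ : K → F` turns a relation over `K` into a relation over `F`
  refine (Module.forall_dual_apply_eq_zero_iff F (c i)).mp fun κ => ?_
  refine hb s (fun i => κ (c i)) ?_ i hi
  ext m
  have h := congrArg (fun f => κ (coeff m f)) hc
  have e : ∀ i, κ (coeff m (c i • map (algebraMap F K) (b i))) = κ (c i) * coeff m (b i) := by
    intro i
    rw [coeff_smul, coeff_map, smul_eq_mul, mul_comm, ← Algebra.smul_def, map_smul, smul_eq_mul,
      mul_comm]
  simp only [coeff_sum, map_sum, e, coeff_zero, map_zero] at h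
  simpa only [coeff_sum, coeff_smul, smul_eq_mul, coeff_zero] using h

/-- Extension of scalars preserves the dimension of a space of polynomials. -/
theorem finrank_span_map_algebraMap {F : Type*} [Field F] [Algebra F K] {τ : Type*}
    (W : Submodule F (MvPolynomial τ F)) [Module.Finite F W] :
    Module.finrank K (Submodule.span K (map (algebraMap F K) '' (W : Set (MvPolynomial τ F)))) =
      Module.finrank F W := by
  let b := Module.finBasis F W
  have hb : LinearIndependent F fun i => (b i : MvPolynomial τ F) :=
    b.linearIndependent.map' W.subtype W.ker_subtype
  have h := finrank_span_eq_card (linearIndependent_map_algebraMap (K := K) hb)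
  rw [Fintype.card_fin] at h
  rw [← h]
  suffices e : Submodule.span K (map (algebraMap F K) '' (W : Set (MvPolynomial τ F))) =
      Submodule.span K (Set.range fun i => map (algebraMap F K) (b i : MvPolynomial τ F)) by rw [e]
  apply le_antisymm
  · rw [Submodule.span_le]
    rintro _ ⟨f, hf, rfl⟩
    have : f = ∑ i, b.repr ⟨f, hf⟩ i • (b i : MvPolynomial τ F) := by
      have e := congrArg Subtype.val (b.sum_repr ⟨f, hf⟩)
      simp only [Submodule.coe_sum, Submodule.coe_smul] at e
      exact e.symm
    rw [this, map_sum]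
    refine Submodule.sum_mem _ fun i _ => ?_
    rw [smul_eq_C_mul, map_mul, map_C, ← smul_eq_C_mul]
    exact Submodule.smul_mem _ _ (Submodule.subset_span ⟨i, rfl⟩)
  · refine Submodule.span_mono ?_
    rintro _ ⟨i, rfl⟩
    exact ⟨_, (b i).2, rfl⟩

instance finite_homogeneousSubmodule (n : ℕ) :
    Module.Finite K (homogeneousSubmodule (Fin t) K n) := by
  rw [homogeneousSubmodule_eq_span]
  exact Module.Finite.span_of_finite K
    ((Finsupp.finite_of_degree_le n |>.subset fun u hu => hu.le).image _)

theorem map_twistedSq {F : Type*} [Field F] [Algebra F K] (k : ℕ) (f : MvPolynomial (Fin t) F) :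
    map (algebraMap F K) (twistedSq F σ k f) = twistedSq K σ k (map (algebraMap F K) f) := by
  have h : (Polynomial.mapRingHom (map (algebraMap F K))).comp
      (twistedTotalSq F σ).toRingHom =
      (twistedTotalSq K σ).toRingHom.comp (map (algebraMap F K)) := by
    apply ringHom_ext
    · intro r
      simp [twistedTotalSq, Polynomial.algebraMap_apply]
    · intro i
      simp [twistedTotalSq]
  have := congrArg (fun φ => (φ f).coeff k) h
  simpa [twistedSq_apply] using this

/-- The space `twistedHit` is defined over every subfield of `K`. -/
theorem span_map_twistedHit {F : Type*} [Field F] [Algebra F K] (n : ℕ) :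
    Submodule.span K (map (algebraMap F K) '' (twistedHit F σ n : Set (MvPolynomial (Fin t) F))) =
      twistedHit K σ n := by
  have h : ∀ i v, map (algebraMap F K) (twistedSq F σ (2 ^ i) (monomial v 1)) =
      twistedSq K σ (2 ^ i) (monomial v 1) := fun i v => by
    rw [map_twistedSq, map_monomial, map_one]
  apply le_antisymm
  · rw [Submodule.span_le]
    rintro _ ⟨f, hf, rfl⟩
    rw [twistedHit_eq_span] at hf
    induction hf using Submodule.span_induction with
    | mem f hf =>
      obtain ⟨i, v, hi, hv, rfl⟩ := hf
      rw [h, twistedHit_eq_span]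
      exact Submodule.subset_span ⟨i, v, hi, hv, rfl⟩
    | zero => simp
    | add f g _ _ hf hg => rw [map_add]; exact add_mem hf hg
    | smul c f _ hf =>
      rw [smul_eq_C_mul, map_mul, map_C, ← smul_eq_C_mul]
      exact Submodule.smul_mem _ _ hf
  · rw [twistedHit_eq_span K, Submodule.span_le]
    rintro _ ⟨i, v, hi, hv, rfl⟩
    refine Submodule.subset_span ⟨_, ?_, h i v⟩
    rw [twistedHit_eq_span]
    exact Submodule.subset_span ⟨i, v, hi, hv, rfl⟩

instance finite_twistedHit (n : ℕ) : Module.Finite K (twistedHit K σ n) := by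
  rw [twistedHit_eq_span]
  refine Module.Finite.span_of_finite K ((((Set.finite_Iic n).prod
    (Finsupp.finite_of_degree_le (σ := Fin t) n)).image
      fun p => twistedSq K σ (2 ^ p.1) (monomial p.2 1)).subset ?_)
  rintro _ ⟨i, v, hi, hv, rfl⟩
  exact ⟨(i, v), ⟨(Nat.lt_two_pow_self.le.trans hi), hv.trans_le (Nat.sub_le _ _)⟩, rfl⟩

theorem twistedSq_zero_X_mul (i : Fin t) (f : MvPolynomial (Fin t) K) :
    twistedSq K σ 0 (X i * f) = X i * twistedSq K σ 0 f := by
  simp [twistedSq_apply, twistedTotalSq, Polynomial.mul_coeff_zero]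

theorem twistedSq_succ_X_mul (k : ℕ) (i : Fin t) (f : MvPolynomial (Fin t) K) :
    twistedSq K σ (k + 1) (X i * f) =
      X i * twistedSq K σ (k + 1) f + X (σ i) ^ 2 * twistedSq K σ k f := by
  rw [twistedSq_apply, twistedSq_apply, twistedSq_apply, map_mul, twistedTotalSq, aeval_X, add_mul,
    Polynomial.coeff_add, Polynomial.coeff_C_mul, mul_assoc, Polynomial.coeff_C_mul,
    Polynomial.coeff_X_mul]

theorem twistedSq_one (k : ℕ) : twistedSq K σ k 1 = if k = 0 then 1 else 0 := by
  rw [twistedSq_apply, map_one, Polynomial.coeff_one]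

/-- A grading in which `x_{σ i}²` is heavier than `x_i` by a constant `d` is respected by the
twisted squares, which raise it by `k • d`. With `d = 1` this covers the degree, and with `d = 0`
the grading by `ZMod 31` below. -/
theorem isWeightedHomogeneous_twistedSq_monomial {M : Type*} [AddCommMonoid M] {w : Fin t → M}
    {d : M} (hw : ∀ i, 2 • w (σ i) = w i + d) (v : Fin t →₀ ℕ) (k : ℕ) :
    (twistedSq K σ k (monomial v 1)).IsWeightedHomogeneous w (Finsupp.weight w v + k • d) := by
  induction hn : v.degree generalizing v k with
  | zero =>
    obtain rfl : v = 0 := (Finsupp.degree_eq_zero_iff v).mp hn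
    rw [show monomial (0 : Fin t →₀ ℕ) (1 : K) = 1 from rfl, twistedSq_one]
    split_ifs with h
    · subst h
      simpa using isWeightedHomogeneous_one K w
    · exact isWeightedHomogeneous_zero K w _
  | succ n ih =>
    obtain ⟨i, hi⟩ : ∃ i, v i ≠ 0 := by
      by_contra! h
      have : v = 0 := Finsupp.ext h
      simp [this] at hn
    obtain ⟨u, rfl⟩ : ∃ u, v = Finsupp.single i 1 + u :=
      ⟨v - Finsupp.single i 1,
        (add_tsub_cancel_of_le (by simpa [Nat.one_le_iff_ne_zero] using hi)).symm⟩
    have hu : u.degree = n := by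
      simp only [map_add, Finsupp.degree_single] at hn
      omega
    have hX : (monomial (Finsupp.single i 1 + u) (1 : K)) = X i * monomial u 1 := by
      rw [X, monomial_mul, one_mul]
    have hwt : Finsupp.weight w (Finsupp.single i 1 + u) = w i + Finsupp.weight w u := by
      simp [Finsupp.weight_single]
    rw [hX, hwt]
    cases k with
    | zero =>
      rw [twistedSq_zero_X_mul]
      have := (isWeightedHomogeneous_X K w i).mul (ih u 0 hu)
      simpa [add_assoc] using this
    | succ k =>
      rw [twistedSq_succ_X_mul]
      refine IsWeightedHomogeneous.add ?_ ?_
      · have := (isWeightedHomogeneous_X K w i).mul (ih u (k + 1) hu)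
        rwa [← add_assoc] at this
      · have := ((isWeightedHomogeneous_X K w (σ i)).pow 2).mul (ih u k hu)
        rw [hw] at this
        convert this using 1
        rw [succ_nsmul]
        abel

theorem twistedHit_le_homogeneousSubmodule (n : ℕ) :
    twistedHit K σ n ≤ homogeneousSubmodule (Fin t) K n := by
  rw [twistedHit_eq_span, Submodule.span_le]
  rintro _ ⟨i, v, hi, hv, rfl⟩
  have := isWeightedHomogeneous_twistedSq_monomial (K := K) (σ := σ) (w := (1 : Fin t → ℕ)) (d := 1)
    (fun _ => rfl) v (2 ^ i)
  have e : Finsupp.weight (1 : Fin t → ℕ) v + 2 ^ i • 1 = n := by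
    have hv' : v.degree = Finsupp.weight (1 : Fin t → ℕ) v := by
      rw [Finsupp.degree_eq_weight_one]
      rfl
    rw [← hv', hv, smul_eq_mul, mul_one, Nat.sub_add_cancel hi]
  rw [e] at this
  exact this

end Twisted

end

/-! ### Linear substitutions and the diagonalization of the Singer cycle -/

section

open MvPolynomial

section LinearSubstitution

variable {K : Type*} [Field K] {t : ℕ}

/-- The linear substitution `x_i ↦ ∑ j, A i j x_j`. -/
noncomputable def linearSubst (A : Matrix (Fin t) (Fin t) K) :
    MvPolynomial (Fin t) K →ₐ[K] MvPolynomial (Fin t) K :=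
  aeval fun i => ∑ j, C (A i j) * X j

theorem linearSubst_X (A : Matrix (Fin t) (Fin t) K) (i : Fin t) :
    linearSubst A (X i) = ∑ j, C (A i j) * X j := by simp [linearSubst]

theorem linearSubst_comp (A B : Matrix (Fin t) (Fin t) K) :
    (linearSubst B).comp (linearSubst A) = linearSubst (A * B) := by
  apply algHom_ext
  intro i
  simp only [AlgHom.comp_apply, linearSubst_X, map_sum, map_mul, Matrix.mul_apply,
    Finset.sum_mul, Finset.mul_sum, ← algebraMap_eq, AlgHom.commutes]
  rw [Finset.sum_comm]
  simp only [mul_assoc]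

theorem linearSubst_one : linearSubst (1 : Matrix (Fin t) (Fin t) K) = AlgHom.id K _ := by
  apply algHom_ext
  intro i
  rw [linearSubst_X, Finset.sum_eq_single i]
  · simp
  · intro j _ hj
    simp [Matrix.one_apply_ne' hj]
  · simp

theorem isHomogeneous_linearSubst (A : Matrix (Fin t) (Fin t) K) {n : ℕ}
    {f : MvPolynomial (Fin t) K} (hf : f.IsHomogeneous n) : (linearSubst A f).IsHomogeneous n := by
  have h := hf.aeval (fun i => ∑ j, C (A i j) * X j) (n := 1) fun i =>
    IsHomogeneous.sum _ _ _ fun j _ => by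
      simpa using (isHomogeneous_C (Fin t) (A i j)).mul (isHomogeneous_X K j)
  rwa [one_mul] at h

/-- The linear substitution by an invertible matrix, as an automorphism. -/
noncomputable def linearSubstEquiv (A B : Matrix (Fin t) (Fin t) K) (hAB : A * B = 1)
    (hBA : B * A = 1) :
    MvPolynomial (Fin t) K ≃ₐ[K] MvPolynomial (Fin t) K :=
  AlgEquiv.ofAlgHom (linearSubst A) (linearSubst B)
    (by rw [linearSubst_comp, hBA, linearSubst_one])
    (by rw [linearSubst_comp, hAB, linearSubst_one])

/-- If squaring the entries of `A` permutes its columns by `σ⁻¹`, then the substitution by `A`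
carries the squares to the squares twisted by `σ`: in characteristic two,
`(∑ j, A i j x_j)² = ∑ j, (A i j)² x_j² = ∑ j, A i j x_{σ j}²`. -/
theorem twistedSq_linearSubst [CharP K 2] {σ : Equiv.Perm (Fin t)}
    {A : Matrix (Fin t) (Fin t) K} (hA : ∀ i j, A i (σ j) ^ 2 = A i j)
    (k : ℕ) (f : MvPolynomial (Fin t) K) :
    twistedSq K σ k (linearSubst A f) = linearSubst A (twistedSq K id k f) := by
  have h : (twistedTotalSq K σ).toRingHom.comp (linearSubst A).toRingHom =
      (Polynomial.mapRingHom (linearSubst A).toRingHom).comp (twistedTotalSq K id).toRingHom := by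
    apply ringHom_ext
    · intro r
      simp [twistedTotalSq, linearSubst, Polynomial.algebraMap_apply]
    · intro i
      have e : (∑ j, C (A i j) * X j : MvPolynomial (Fin t) K) ^ 2 =
          ∑ j, C (A i j) * X (σ j) ^ 2 := by
        rw [CharTwo.sum_sq, ← Equiv.sum_comp σ]
        refine Finset.sum_congr rfl fun j _ => ?_
        rw [mul_pow, ← C_pow, hA]
      have e2 : ∀ r : K, twistedTotalSq K σ (C r) = Polynomial.C (C r) := fun r => by
        simp [twistedTotalSq, Polynomial.algebraMap_apply]
      have e3 : ∀ j, twistedTotalSq K σ (X j) =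
          Polynomial.C (X j) + Polynomial.C (X (σ j) ^ 2) * Polynomial.X := fun j => by
        simp [twistedTotalSq]
      have e4 : twistedTotalSq K (id : Fin t → Fin t) (X i) =
          Polynomial.C (X i) + Polynomial.C (X i ^ 2) * Polynomial.X := by
        simp [twistedTotalSq]
      simp only [AlgHom.toRingHom_eq_coe, RingHom.comp_apply, RingHom.coe_coe, linearSubst_X,
        map_sum, map_mul, e2, e3, e4, Polynomial.coe_mapRingHom, Polynomial.map_add,
        Polynomial.map_mul, Polynomial.map_C, Polynomial.map_X]
      rw [map_pow (linearSubst A), linearSubst_X, e, map_sum, Finset.sum_mul,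
        ← Finset.sum_add_distrib]
      refine Finset.sum_congr rfl fun j _ => ?_
      rw [map_mul]
      ring
  have := congrArg (fun φ => (φ f).coeff k) h
  simpa [twistedSq_apply] using this

theorem finrank_twistedHit_eq [CharP K 2] {σ : Equiv.Perm (Fin t)}
    {A : Matrix (Fin t) (Fin t) K} (hA : ∀ i j, A i (σ j) ^ 2 = A i j) (hdet : A.det ≠ 0) (n : ℕ) :
    Module.finrank K (twistedHit K (id : Fin t → Fin t) n) =
      Module.finrank K (twistedHit K σ n) := by
  have hu : IsUnit A.det := isUnit_iff_ne_zero.mpr hdet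
  let Φ := linearSubstEquiv A A⁻¹ (A.mul_nonsing_inv hu) (A.nonsing_inv_mul hu)
  have hΦ : ∀ f, Φ f = linearSubst A f := fun _ => rfl
  have hhom : ∀ m, (homogeneousSubmodule (Fin t) K m).map Φ.toLinearEquiv.toLinearMap =
      homogeneousSubmodule (Fin t) K m := by
    intro m
    apply le_antisymm
    · rintro _ ⟨f, hf, rfl⟩
      exact isHomogeneous_linearSubst A hf
    · intro f hf
      exact ⟨linearSubst A⁻¹ f, isHomogeneous_linearSubst _ hf, Φ.apply_symm_apply f⟩
  have h : (twistedHit K (id : Fin t → Fin t) n).map Φ.toLinearEquiv.toLinearMap =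
      twistedHit K σ n := by
    simp only [twistedHit, Submodule.map_iSup]
    refine iSup_congr fun i => iSup_congr fun _ => ?_
    rw [← Submodule.map_comp]
    conv_rhs => rw [← hhom, ← Submodule.map_comp]
    congr 1
    refine LinearMap.ext fun f => ?_
    exact (twistedSq_linearSubst hA _ f).symm
  rw [← h]
  exact (LinearEquiv.finrank_map_eq Φ.toLinearEquiv _).symm

end LinearSubstitution

/-- The cyclic permutation `j ↦ j - 1` of the five indices. -/
def cyc : Equiv.Perm (Fin 5) := Equiv.subRight 1

/-- The matrix with entries `(a ^ i) ^ 2 ^ j`, for an element `a` of order `31` in the field with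
`32` elements. It is a Vandermonde matrix on the five distinct conjugates of `a`. -/
theorem exists_moore_matrix : ∃ A : Matrix (Fin 5) (Fin 5) (GaloisField 2 5),
    (∀ i j, A i (cyc j) ^ 2 = A i j) ∧ A.det ≠ 0 := by
  have hcard : Nat.card (GaloisField 2 5) = 32 := GaloisField.card 2 5 (by norm_num)
  have : Fintype (GaloisField 2 5) := Fintype.ofFinite _
  have hcard' : Fintype.card (GaloisField 2 5) = 32 := by rw [← Nat.card_eq_fintype_card, hcard]
  classical
  obtain ⟨a, ha0, ha1⟩ : ∃ a : GaloisField 2 5, a ≠ 0 ∧ a ≠ 1 := by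
    by_contra! h
    have : Finset.univ ⊆ ({0, 1} : Finset (GaloisField 2 5)) := fun a _ => by
      by_cases h0 : a = 0
      · simp [h0]
      · simp [h a h0]
    have := Finset.card_le_card this
    rw [Finset.card_univ, hcard'] at this
    have := Finset.card_le_two (a := (0 : GaloisField 2 5)) (b := 1)
    omega
  have hord : orderOf a = 31 := by
    refine orderOf_eq_prime ?_ ha1 (hp := ⟨by norm_num⟩)
    have := FiniteField.pow_card_sub_one_eq_one a ha0
    rwa [hcard'] at this
  refine ⟨(Matrix.vandermonde fun j : Fin 5 => a ^ 2 ^ (j : ℕ)).transpose, ?_, ?_⟩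
  · intro i j
    simp only [Matrix.transpose_apply, Matrix.vandermonde_apply]
    have h : (2 ^ (cyc j : ℕ) * 2 : ℕ) % 31 = 2 ^ (j : ℕ) % 31 := by
      revert j; decide
    rw [pow_right_comm, ← pow_mul a, ← pow_mod_orderOf a, hord, h, ← hord, pow_mod_orderOf]
  · rw [Matrix.det_transpose, Matrix.det_vandermonde_ne_zero_iff]
    intro i j hij
    have hlt : ∀ i : Fin 5, 2 ^ (i : ℕ) ∈ Set.Iio (orderOf a) := by
      rw [hord]
      decide
    exact Fin.ext (Nat.pow_right_injective le_rfl (pow_injOn_Iio_orderOf (hlt i) (hlt j) hij))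

/-- Both spaces become isomorphic over the field with `32` elements. -/
theorem finrank_hit_eq_cyc (n : ℕ) :
    Module.finrank (ZMod 2) (hit 5 n) = Module.finrank (ZMod 2) (twistedHit (ZMod 2) cyc n) := by
  obtain ⟨A, hA, hdet⟩ := exists_moore_matrix
  rw [hit_eq_twistedHit, ← finrank_span_map_algebraMap (K := GaloisField 2 5),
    span_map_twistedHit, finrank_twistedHit_eq hA hdet, ← span_map_twistedHit (F := ZMod 2),
    finrank_span_map_algebraMap]

end

/-! ### The grading by `ZMod 31` -/

section

open MvPolynomial

theorem finrank_iSup_of_iSupIndep {K V ι : Type*} [Field K] [AddCommGroup V] [Module K V]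
    [Fintype ι] {H : ι → Submodule K V} [∀ i, Module.Finite K (H i)] (h : iSupIndep H) :
    Module.finrank K (⨆ i, H i : Submodule K V) = ∑ i, Module.finrank K (H i) := by
  classical
  rw [Submodule.iSup_eq_range_dfinsupp_lsum,
    LinearMap.finrank_range_of_inj h.dfinsupp_lsum_injective]
  exact Module.finrank_directSum (R := K) fun i => H i

/-- The weight of the `j`-th variable in the grading by `ZMod 31`. -/
def cycWeight (j : Fin 5) : ZMod 31 := 2 ^ (j : ℕ)

/-- The block of weight `w` of `twistedHit`, spanned by the squares of the monomials of weight
`w`. -/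
noncomputable def blockHit (n : ℕ) (w : ZMod 31) : Submodule (ZMod 2) (P 5) :=
  Submodule.span (ZMod 2) {f | ∃ (i : ℕ) (v : Fin 5 →₀ ℕ), 2 ^ i ≤ n ∧ v.degree = n - 2 ^ i ∧
    Finsupp.weight cycWeight v = w ∧ f = twistedSq (ZMod 2) cyc (2 ^ i) (monomial v 1)}

theorem twistedHit_eq_iSup_blockHit (n : ℕ) :
    twistedHit (ZMod 2) cyc n = ⨆ w, blockHit n w := by
  rw [twistedHit_eq_span]
  apply le_antisymm
  · rw [Submodule.span_le]
    rintro _ ⟨i, v, hi, hv, rfl⟩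
    exact Submodule.mem_iSup_of_mem (Finsupp.weight cycWeight v)
      (Submodule.subset_span ⟨i, v, hi, hv, rfl, rfl⟩)
  · refine iSup_le fun w => Submodule.span_mono ?_
    rintro _ ⟨i, v, hi, hv, -, rfl⟩
    exact ⟨i, v, hi, hv, rfl⟩

theorem blockHit_le_twistedHit (n : ℕ) (w : ZMod 31) :
    blockHit n w ≤ twistedHit (ZMod 2) cyc n := by
  rw [twistedHit_eq_iSup_blockHit]
  exact le_iSup _ w

instance finite_blockHit (n : ℕ) (w : ZMod 31) : Module.Finite (ZMod 2) (blockHit n w) :=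
  Submodule.finiteDimensional_of_le (blockHit_le_twistedHit n w)

/-- Twice the weight of `y_{j-1}` is the weight of `y_j`, also for `j = 0`, as `2 ^ 5 = 1` in
`ZMod 31`. So the twisted squares preserve the weight. -/
theorem two_nsmul_cycWeight (i : Fin 5) : 2 • cycWeight (cyc i) = cycWeight i + 0 := by
  revert i; decide

theorem blockHit_le_weightedHomogeneousSubmodule (n : ℕ) (w : ZMod 31) :
    blockHit n w ≤ weightedHomogeneousSubmodule (ZMod 2) cycWeight w := by
  rw [blockHit, Submodule.span_le]
  rintro _ ⟨i, v, -, -, rfl, rfl⟩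
  have := isWeightedHomogeneous_twistedSq_monomial (K := ZMod 2) two_nsmul_cycWeight v (2 ^ i)
  rwa [smul_zero, add_zero] at this

theorem finrank_twistedHit_eq_sum (n : ℕ) : Module.finrank (ZMod 2) (twistedHit (ZMod 2) cyc n) =
    ∑ w, Module.finrank (ZMod 2) (blockHit n w) := by
  rw [twistedHit_eq_iSup_blockHit]
  refine finrank_iSup_of_iSupIndep (iSupIndep.mono ?_ (blockHit_le_weightedHomogeneousSubmodule n))
  classical
  have := weightedDecomposition (ZMod 2) cycWeight
  exact (DirectSum.Decomposition.isInternal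
    (weightedHomogeneousSubmodule (ZMod 2) cycWeight)).submodule_iSupIndep

theorem twistedSq_rename (K : Type*) [Field K] {t : ℕ} {σ : Fin t → Fin t} {τ : Fin t → Fin t}
    (h : ∀ i, σ (τ i) = τ (σ i)) (k : ℕ) (f : MvPolynomial (Fin t) K) :
    twistedSq K σ k (rename τ f) = rename τ (twistedSq K σ k f) := by
  have h : (twistedTotalSq K σ).toRingHom.comp (rename τ).toRingHom =
      (Polynomial.mapRingHom (rename τ).toRingHom).comp (twistedTotalSq K σ).toRingHom := by
    apply ringHom_ext
    · intro r
      simp [twistedTotalSq, Polynomial.algebraMap_apply]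
    · intro i
      simp [twistedTotalSq, h]
  have := congrArg (fun φ => (φ f).coeff k) h
  simpa [twistedSq_apply] using this

theorem weight_mapDomain_cyc_symm (v : Fin 5 →₀ ℕ) :
    Finsupp.weight cycWeight (v.mapDomain cyc.symm) = 2 * Finsupp.weight cycWeight v := by
  have h : ∀ i, cycWeight (cyc.symm i) = 2 * cycWeight i := by decide
  simp only [Finsupp.weight_apply]
  rw [Finsupp.sum_mapDomain_index (by simp) (fun _ _ _ => add_smul _ _ _), Finsupp.mul_sum]
  simp only [h, mul_smul_comm]

/-- The shift of the variables commutes with the twisted squares and doubles the weight. -/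
theorem finrank_blockHit_le (n : ℕ) (w : ZMod 31) :
    Module.finrank (ZMod 2) (blockHit n w) ≤ Module.finrank (ZMod 2) (blockHit n (2 * w)) := by
  have hinj : Function.Injective (rename (R := ZMod 2) cyc.symm) :=
    rename_injective _ cyc.symm.injective
  rw [(Submodule.equivMapOfInjective (rename (R := ZMod 2) cyc.symm).toLinearMap hinj _).finrank_eq]
  refine Submodule.finrank_mono ?_
  rw [blockHit, Submodule.map_span, Submodule.span_le]
  rintro _ ⟨_, ⟨i, v, hi, hv, rfl, rfl⟩, rfl⟩
  refine Submodule.subset_span ⟨i, v.mapDomain cyc.symm, hi, ?_, weight_mapDomain_cyc_symm v, ?_⟩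
  · rw [← hv]
    exact Finsupp.degree_mapDomain _ _
  · rw [← rename_monomial, twistedSq_rename]
    · rfl
    · decide

theorem finrank_blockHit_two_mul (n : ℕ) (w : ZMod 31) :
    Module.finrank (ZMod 2) (blockHit n (2 * w)) = Module.finrank (ZMod 2) (blockHit n w) := by
  apply le_antisymm _ (finrank_blockHit_le n w)
  -- doubling has order five, so that the inequality closes up to a cycle
  have h5 : 2 * (2 * (2 * (2 * (2 * w)))) = w := by revert w; decide
  calc _ ≤ _ := finrank_blockHit_le n _
    _ ≤ _ := finrank_blockHit_le n _
    _ ≤ _ := finrank_blockHit_le n _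
    _ ≤ _ := finrank_blockHit_le n _
    _ = _ := by rw [h5]

/-- Doubling on `ZMod 31` fixes `0` and has six orbits of length five on the rest. -/
theorem sum_eq_of_two_mul_invariant {r : ZMod 31 → ℕ} (h : ∀ w, r (2 * w) = r w) :
    ∑ w, r w = r 0 + 5 * (r 1 + r 3 + r 5 + r 7 + r 11 + r 15) := by
  have hu : (Finset.univ : Finset (ZMod 31)) = {0} ∪ (({1, 3, 5, 7, 11, 15} : Finset (ZMod 31)) ×ˢ
      Finset.range 5).image fun p => 2 ^ p.2 * p.1 := by decide
  have hp : ∀ (e : ℕ) w, r (2 ^ e * w) = r w := by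
    intro e w
    induction e with
    | zero => simp
    | succ e ih => rw [pow_succ', mul_assoc, h, ih]
  rw [hu, Finset.sum_union (by decide), Finset.sum_image (by decide), Finset.sum_product]
  have h6 : ∑ w ∈ ({1, 3, 5, 7, 11, 15} : Finset (ZMod 31)), r w =
      r 1 + r 3 + r 5 + r 7 + r 11 + r 15 := by
    iterate 5 rw [Finset.sum_insert (by decide)]
    rw [Finset.sum_singleton]
    ring
  simp only [hp, Finset.sum_singleton, Finset.sum_const, Finset.card_range, smul_eq_mul]
  rw [← Finset.mul_sum, h6]

end

/-! ### Admissible monomials form a basis -/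

section

open MvPolynomial

theorem finrank_homogeneousSubmodule (K : Type*) [Field K] (t n : ℕ) :
    Module.finrank K (homogeneousSubmodule (Fin t) K n) =
      (Finset.finsuppAntidiag (Finset.univ : Finset (Fin t)) n).card := by
  have hli : LinearIndependent K fun u : {u : Fin t →₀ ℕ // u.degree = n} =>
      (monomial (u : Fin t →₀ ℕ) (1 : K)) := by
    have := (basisMonomials (Fin t) K).linearIndependent.comp
      (fun u : {u : Fin t →₀ ℕ // u.degree = n} => (u : Fin t →₀ ℕ)) Subtype.val_injective
    simpa [Function.comp_def] using this
  have hfin : Finite {u : Fin t →₀ ℕ // u.degree = n} :=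
    (Finsupp.finite_of_degree_le (σ := Fin t) n).subset fun u hu => le_of_eq hu
  have := Fintype.ofFinite {u : Fin t →₀ ℕ // u.degree = n}
  have h := finrank_span_eq_card hli
  rw [homogeneousSubmodule_eq_span, Set.image_eq_range]
  refine h.trans ?_
  refine Fintype.card_of_subtype _ fun u => ?_
  rw [Finset.mem_finsuppAntidiag]
  simp [Finsupp.degree_eq_sum]

/-- The weight vector and the exponent vector of a monomial, as an element of a linear order. -/
def monomialKey {t : ℕ} (u : Fin t →₀ ℕ) : Lex (ℕ → ℕ) ×ₗ Lex (Fin t → ℕ) :=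
  toLex (toLex (weight u), toLex (u : Fin t → ℕ))

theorem monomialLT_iff {t : ℕ} (u v : Fin t →₀ ℕ) :
    MonomialLT u v ↔ monomialKey u < monomialKey v := by
  rw [monomialKey, monomialKey, Prod.Lex.toLex_lt_toLex]
  rfl

theorem monomialKey_injective {t : ℕ} : Function.Injective (monomialKey (t := t)) := by
  intro u v h
  exact DFunLike.coe_injective (congrArg (fun p => ofLex (ofLex p).2) h)

theorem finite_admissibleMonomials (t n : ℕ) : (admissibleMonomials t n).Finite :=
  (Finsupp.finite_of_degree_le (σ := Fin t) n).subset fun _ hu => hu.1.le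

theorem monomial_mem_span_admissible {t n : ℕ} (u : Fin t →₀ ℕ) (hu : u.degree = n) :
    (hit t n).mkQ (monomial u 1) ∈ Submodule.span (ZMod 2)
      ((fun u => (hit t n).mkQ (monomial u 1)) '' admissibleMonomials t n) := by
  have hfin : {v : Fin t →₀ ℕ | v.degree = n}.Finite :=
    (Finsupp.finite_of_degree_le (σ := Fin t) n).subset fun u hu => le_of_eq hu
  have hso : IsStrictOrder (Fin t →₀ ℕ) fun u v => monomialKey u < monomialKey v :=
    { irrefl := fun _ => lt_irrefl _
      trans := fun _ _ _ => lt_trans }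
  refine hfin.wellFoundedOn.induction (r := fun u v => monomialKey u < monomialKey v)
    (P := fun u => (hit t n).mkQ (monomial u 1) ∈ Submodule.span (ZMod 2)
      ((fun u => (hit t n).mkQ (monomial u 1)) '' admissibleMonomials t n)) hu fun u hu ih => ?_
  by_cases had : Inadmissible u
  · obtain ⟨S, hS, hmem⟩ := had
    rw [hu] at hmem
    have e : (hit t n).mkQ (monomial u 1) = (hit t n).mkQ (∑ v ∈ S, monomial v 1) :=
      (Submodule.Quotient.eq (hit t n)).mpr hmem
    rw [e, map_sum]
    exact Submodule.sum_mem _ fun v hv => ih v ((hS v hv).1.trans hu)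
      ((monomialLT_iff v u).mp (hS v hv).2)
  · exact Submodule.subset_span ⟨u, ⟨hu, had⟩, rfl⟩

theorem linearIndependent_admissible (t n : ℕ) :
    LinearIndependent (ZMod 2) fun u : admissibleMonomials t n =>
      (hit t n).mkQ (monomial (u : Fin t →₀ ℕ) 1) := by
  classical
  rw [linearIndependent_iff']
  intro s g hg
  by_contra! hne
  have hT : (s.filter fun u => g u ≠ 0).Nonempty := by
    obtain ⟨u, hu, hgu⟩ := hne
    exact ⟨u, Finset.mem_filter.mpr ⟨hu, hgu⟩⟩
  obtain ⟨u, huT, hmax⟩ := Finset.exists_max_image _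
    (fun u : admissibleMonomials t n => monomialKey (u : Fin t →₀ ℕ)) hT
  -- the largest monomial in the relation is congruent to the sum of the others
  refine u.2.2 ⟨((s.filter fun u => g u ≠ 0).erase u).map (Function.Embedding.subtype _), ?_, ?_⟩
  · simp only [Finset.mem_map, Finset.mem_erase]
    rintro _ ⟨v, ⟨hvu, hv⟩, rfl⟩
    refine ⟨v.2.1.trans u.2.1.symm, (monomialLT_iff _ _).mpr (lt_of_le_of_ne (hmax v hv) ?_)⟩
    exact fun h => hvu (Subtype.ext (monomialKey_injective h))
  · rw [Finset.sum_map, CharTwo.sub_eq_add, u.2.1]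
    have h2 : (hit t n).mkQ (∑ v ∈ s.filter fun u => g u ≠ 0, monomial (v : Fin t →₀ ℕ) 1) = 0 := by
      rw [← hg, map_sum, Finset.sum_filter]
      refine Finset.sum_congr rfl fun v _ => ?_
      split_ifs with h
      · have h1 : g v = 1 := Fin.eq_one_of_ne_zero _ h
        rw [h1, one_smul]
      · rw [not_not.mp h, zero_smul]
    rw [← Finset.add_sum_erase _ _ huT] at h2
    exact (Submodule.Quotient.mk_eq_zero _).mp h2

theorem ncard_admissibleMonomials (t n : ℕ) : (admissibleMonomials t n).ncard =
    Module.finrank (ZMod 2) ((homogeneousSubmodule (Fin t) (ZMod 2) n).map (hit t n).mkQ) := by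
  have := (finite_admissibleMonomials t n).fintype
  have h := finrank_span_eq_card (linearIndependent_admissible t n)
  rw [← Nat.card_coe_set_eq, Nat.card_eq_fintype_card, ← h, ← Set.image_eq_range
    (fun u => (hit t n).mkQ (monomial u 1))]
  suffices e : Submodule.span (ZMod 2) ((fun u => (hit t n).mkQ (monomial u 1)) ''
      admissibleMonomials t n) =
      (homogeneousSubmodule (Fin t) (ZMod 2) n).map (hit t n).mkQ by rw [e]
  rw [homogeneousSubmodule_eq_span, Submodule.map_span, ← Set.image_comp]
  apply le_antisymm
  · exact Submodule.span_mono (Set.image_mono fun u hu => hu.1)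
  · rw [Submodule.span_le]
    rintro _ ⟨u, hu, rfl⟩
    exact monomial_mem_span_admissible u hu

/-- The rank formula for a map restricted to `U`, with kernel `H` there. -/
theorem finrank_map_add_finrank_of_ker {F V W : Type*} [Field F] [AddCommGroup V] [Module F V]
    [AddCommGroup W] [Module F W] (f : V →ₗ[F] W) (U H : Submodule F V) [Module.Finite F U]
    (hHU : H ≤ U) (h : ∀ x ∈ U, f x = 0 ↔ x ∈ H) :
    Module.finrank F (U.map f) + Module.finrank F H = Module.finrank F U := by
  rw [← LinearMap.finrank_range_add_finrank_ker (f.domRestrict U), LinearMap.range_domRestrict]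
  congr 1
  have : LinearMap.ker (f.domRestrict U) = H.comap U.subtype := by
    ext x
    simpa using h x x.2
  rw [this]
  exact (Submodule.comapSubtypeEquivOfLe hHU).finrank_eq.symm

end

/-! ### Indecomposables -/

section

open MvPolynomial

theorem odd_choose_two_pow_sub_one (m a : ℕ) (ha : a < 2 ^ m) : Odd ((2 ^ m - 1).choose a) := by
  induction a with
  | zero => simp
  | succ a ih =>
    have h := Nat.prime_two.dvd_choose_pow (n := m) (k := a + 1) (by omega) (by omega)
    have e : 2 ^ m = (2 ^ m - 1) + 1 := by omega
    rw [e, Nat.choose_succ_succ, ← even_iff_two_dvd, Nat.even_add'] at h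
    exact h.mp (ih (by omega))

/-- The sum of the images of the squares `Sq^{2^i}`. -/
noncomputable def decomposables (t : ℕ) : Submodule (ZMod 2) (P t) :=
  ⨆ i : ℕ, LinearMap.range (Sq t (2 ^ i))

theorem sq_two_pow_mem_decomposables (t i : ℕ) (f : P t) : Sq t (2 ^ i) f ∈ decomposables t :=
  Submodule.mem_iSup_of_mem i ⟨f, rfl⟩

/-- The squares `Sq^{2^i}` generate: for `k = 2^m + a` with `0 < a < 2^m`, the Adem relation for
`Sq^a Sq^{2^m}` contains `Sq^k` with coefficient `C(2^m - 1, a)`, which is odd. -/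
theorem sq_mem_decomposables (t k : ℕ) (hk : 0 < k) (f : P t) : Sq t k f ∈ decomposables t := by
  induction k using Nat.strong_induction_on generalizing f with
  | _ k ih =>
    obtain ⟨m, hm1, hm2⟩ : ∃ m, 2 ^ m ≤ k ∧ k < 2 ^ (m + 1) :=
      ⟨Nat.log 2 k, Nat.pow_log_le_self 2 hk.ne', Nat.lt_pow_succ_log_self one_lt_two k⟩
    obtain ⟨a, rfl⟩ := Nat.exists_eq_add_of_le' hm1
    rcases Nat.eq_zero_or_pos a with rfl | ha
    · rw [zero_add]
      exact sq_two_pow_mem_decomposables t m f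
    have hab : a < 2 ^ m := by rw [pow_succ] at hm2; omega
    have h := sq_adem t a (2 ^ m) (by omega) f
    rw [Finset.sum_range_succ'] at h
    have hc : (((2 ^ m - 1 - 0).choose (a - 2 * 0) : ℕ) : ZMod 2) = 1 := by
      rw [ZMod.natCast_eq_one_iff_odd]
      exact odd_choose_two_pow_sub_one m a hab
    rw [hc, one_smul, sq_zero, Nat.sub_zero, add_comm, ← sub_eq_iff_eq_add] at h
    rw [← h]
    refine Submodule.sub_mem _ (ih a (by omega) ha _) (Submodule.sum_mem _ fun j hj => ?_)
    have hj := Finset.mem_range.mp hj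
    exact Submodule.smul_mem _ _ (ih _ (by omega) (by omega) _)

theorem act_sub_augmentation_smul_mem (t : ℕ) (θ : SteenrodAlgebra) (f : P t) :
    act t θ f - augmentation θ • f ∈ decomposables t := by
  obtain ⟨θ, rfl⟩ := RingQuot.mkAlgHom_surjective (ZMod 2) AdemRel θ
  induction θ using FreeAlgebra.induction generalizing f with
  | grade0 r => simp [act, augmentation, Algebra.algebraMap_eq_smul_one]
  | grade1 k =>
    rcases Nat.eq_zero_or_pos k with rfl | hk
    · simp [act, augmentation, sq_zero]
    · simpa [act, augmentation, hk.ne'] using sq_mem_decomposables t k hk f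
  | mul a b ha hb =>
    rw [map_mul, map_mul, map_mul, Module.End.mul_apply, mul_smul]
    have := add_mem (ha (act t (RingQuot.mkAlgHom (ZMod 2) AdemRel b) f))
      (Submodule.smul_mem _ (augmentation (RingQuot.mkAlgHom (ZMod 2) AdemRel a)) (hb f))
    rwa [smul_sub, sub_add_sub_cancel] at this
  | add a b ha hb =>
    rw [map_add, map_add, map_add, LinearMap.add_apply, add_smul, add_sub_add_comm]
    exact add_mem (ha f) (hb f)

/-- The class `1 ⊗ f` of a polynomial among the indecomposables. -/
noncomputable def toQ (t : ℕ) : P t →ₗ[ZMod 2] Q t :=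
  (balancing t).mkQ.comp (TensorProduct.mk (ZMod 2) (ZMod 2) (P t) 1)

theorem toQ_eq_zero_iff (t : ℕ) (f : P t) : toQ t f = 0 ↔ f ∈ decomposables t := by
  have h0 : toQ t f = 0 ↔ (1 : ZMod 2) ⊗ₜ[ZMod 2] f ∈ balancing t :=
    Submodule.Quotient.mk_eq_zero _
  rw [h0]
  constructor
  · intro h
    have hle : balancing t ≤
        (decomposables t).comap (TensorProduct.lid (ZMod 2) (P t)).toLinearMap := by
      rw [balancing, Submodule.span_le]
      rintro _ ⟨c, θ, g, rfl⟩
      have := Submodule.smul_mem _ c (Submodule.neg_mem _ (act_sub_augmentation_smul_mem t θ g))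
      rw [neg_sub, smul_sub, smul_smul] at this
      simpa using this
    simpa using hle h
  · intro h
    have hle : decomposables t ≤
        (balancing t).comap (TensorProduct.mk (ZMod 2) (ZMod 2) (P t) 1) := by
      refine iSup_le fun i => ?_
      rintro _ ⟨g, rfl⟩
      have : -((1 * augmentation
          (RingQuot.mkAlgHom (ZMod 2) AdemRel (FreeAlgebra.ι (ZMod 2) (2 ^ i)))) ⊗ₜ[ZMod 2] g -
          (1 : ZMod 2) ⊗ₜ[ZMod 2]
            act t (RingQuot.mkAlgHom (ZMod 2) AdemRel (FreeAlgebra.ι (ZMod 2) (2 ^ i))) g) ∈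
          balancing t :=
        Submodule.neg_mem _ (Submodule.subset_span ⟨1, _, g, rfl⟩)
      simpa [augmentation, act] using this
    exact hle h

theorem hit_le_decomposables (t n : ℕ) : hit t n ≤ decomposables t :=
  iSup₂_le fun i _ => (LinearMap.map_le_range).trans
    (le_iSup (fun i => LinearMap.range (Sq t (2 ^ i))) i)

theorem homogeneousComponent_sq_mem_hit (t n i : ℕ) (f : P t) :
    homogeneousComponent n (Sq t (2 ^ i) f) ∈ hit t n := by
  rw [← f.support_sum_monomial_coeff, map_sum, map_sum]
  refine Submodule.sum_mem _ fun v _ => ?_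
  rw [show monomial v (coeff v f) = coeff v f • monomial v (1 : ZMod 2) by simp [smul_monomial],
    map_smul, map_smul]
  refine Submodule.smul_mem _ _ ?_
  have hm : Sq t (2 ^ i) (monomial v 1) ∈
      homogeneousSubmodule (Fin t) (ZMod 2) (v.degree + 2 ^ i) := by
    refine twistedHit_le_homogeneousSubmodule (K := ZMod 2) (σ := id) _ ?_
    rw [twistedHit_eq_span]
    exact Submodule.subset_span ⟨i, v, by omega, by omega, rfl⟩
  rw [homogeneousComponent_of_mem hm]
  split_ifs with h
  · rw [hit_eq_twistedHit, twistedHit_eq_span]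
    exact Submodule.subset_span ⟨i, v, by omega, by omega, rfl⟩
  · exact zero_mem _

/-- A homogeneous decomposable element is a sum of squares of elements of the complementary
degrees. -/
theorem mem_decomposables_iff_mem_hit {t n : ℕ} {f : P t} (hf : f.IsHomogeneous n) :
    f ∈ decomposables t ↔ f ∈ hit t n := by
  refine ⟨fun h => ?_, fun h => hit_le_decomposables t n h⟩
  have hle : decomposables t ≤ (hit t n).comap (homogeneousComponent n) := by
    refine iSup_le fun i => ?_
    rintro _ ⟨g, rfl⟩
    exact homogeneousComponent_sq_mem_hit t n i g
  have := hle h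
  rwa [Submodule.mem_comap, homogeneousComponent_of_mem hf, if_pos rfl] at this

theorem finrank_Qdeg_add_finrank_hit (t n : ℕ) :
    Module.finrank (ZMod 2) (Qdeg t n) + Module.finrank (ZMod 2) (hit t n) =
      Module.finrank (ZMod 2) (homogeneousSubmodule (Fin t) (ZMod 2) n) :=
  finrank_map_add_finrank_of_ker (toQ t) _ _ (twistedHit_le_homogeneousSubmodule n) fun f hf => by
    rw [toQ_eq_zero_iff, mem_decomposables_iff_mem_hit hf]

theorem ncard_admissibleMonomials_add_finrank_hit (t n : ℕ) :
    (admissibleMonomials t n).ncard + Module.finrank (ZMod 2) (hit t n) =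
      Module.finrank (ZMod 2) (homogeneousSubmodule (Fin t) (ZMod 2) n) := by
  rw [ncard_admissibleMonomials]
  exact finrank_map_add_finrank_of_ker (hit t n).mkQ _ _ (twistedHit_le_homogeneousSubmodule n)
    fun f _ => Submodule.Quotient.mk_eq_zero _

end

/-! ### Gaussian elimination on binary rows -/

/-!
A row is a natural number. Its bits from position `64` on are the vector; the low word is a tag,
added up along with the vector and otherwise ignored. Its only purpose is to keep the low words of
distinct rows distinct, because the kernel hashes numerals by their low word. For the sake of
kernel evaluation the programs below are written with recursors and the binary operations of
`Nat`, and those that return a state pass it to a continuation.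
-/

noncomputable section

/-- The value `f n`, arranged so that `n` is evaluated to a numeral before `f` is called. -/
def withValue {α : Type} (n : ℕ) (f : ℕ → α) : α :=
  Nat.rec (motive := fun _ => α) (f (nat_lit 0)) (fun m _ => f (Nat.succ m)) n

/-- The conditional on a Boolean, without a `Decidable` instance. -/
def ifTrue {α : Type} (c : Bool) (a b : α) : α := Bool.rec (motive := fun _ => α) b a c

/-- A binary tree with natural numbers at the leaves: an array indexed by bit strings, the least
significant bit being read at the root. -/
inductive BitTrie : Type
  | leaf (v : ℕ) : BitTrie
  | node (l r : BitTrie) : BitTrie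

namespace BitTrie

/-- The entry at index `i`. -/
def get (t : BitTrie) : ℕ → ℕ :=
  BitTrie.rec (motive := fun _ => ℕ → ℕ) (fun v _ => v)
    (fun _ _ getl getr i => Nat.rec (motive := fun _ => ℕ) (getl (Nat.div i (nat_lit 2)))
      (fun _ _ => getr (Nat.div i (nat_lit 2))) (Nat.mod i (nat_lit 2))) t

/-- Replaces the entry at index `i` by `v` and passes the resulting tree to the continuation. -/
def setThen (t : BitTrie) : ℕ → ℕ → (BitTrie → ℕ) → ℕ :=
  BitTrie.rec (motive := fun _ => ℕ → ℕ → (BitTrie → ℕ) → ℕ) (fun _ _ v k => k (leaf v))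
    (fun l r setl setr i v k => Nat.rec (motive := fun _ => ℕ)
      (setl (Nat.div i (nat_lit 2)) v fun l' => k (node l' r))
      (fun _ _ => setr (Nat.div i (nat_lit 2)) v fun r' => k (node l r')) (Nat.mod i (nat_lit 2))) t

/-- The tree of depth `d` with all entries zero. -/
def zero (d : ℕ) : BitTrie :=
  Nat.rec (motive := fun _ => BitTrie) (leaf (nat_lit 0)) (fun _ t => node t t) d

end BitTrie

/-- The index at which a row is stored. If `l` is the position of the lowest nonzero entry of the
vector, then `s ^^^ (s - 1) = 2^(l+1) - 1` for `s = r >>> 64`, and this number is reduced modulo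
`11867`. As `2` is a primitive root modulo the prime `11867`, different positions `l < 11866` have
different keys. The proofs do not use this. -/
def pivotKey (r : ℕ) : ℕ :=
  Nat.mod (Nat.xor (Nat.shiftRight r (nat_lit 64))
    (Nat.sub (Nat.shiftRight r (nat_lit 64)) (nat_lit 1))) (nat_lit 11867)

/-- Reduces the row `r` by the stored rows until it vanishes or its key is free; in the latter
case it is stored and the counter `n` is increased. The tree and the counter are passed to the
continuation. The value `0` signals that the fuel is exhausted. -/
def reduceThen (fuel : ℕ) : BitTrie → ℕ → ℕ → (BitTrie → ℕ → ℕ) → ℕ :=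
  Nat.rec (motive := fun _ => BitTrie → ℕ → ℕ → (BitTrie → ℕ → ℕ) → ℕ)
    (fun _ _ _ _ => nat_lit 0)
    (fun _ ih t n r k => withValue r fun r => Nat.rec (motive := fun _ => ℕ) (k t n)
      (fun _ _ => withValue (pivotKey r) fun i => withValue (t.get i) fun p =>
        Nat.rec (motive := fun _ => ℕ) (t.setThen i r fun t' => withValue (Nat.succ n) (k t'))
          (fun _ _ => ih t n (Nat.xor r p) k) p)
      (Nat.shiftRight r (nat_lit 64))) fuel

/-- Inserts the rows one after the other and returns the number of stored rows, the rank. Each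
reduction step clears the lowest nonzero entry, so `12000` steps suffice for vectors of length
less than `12000`; a wrong choice of this bound would show as the value `0`. -/
def eliminate (rows : List ℕ) : BitTrie → ℕ → ℕ :=
  List.rec (motive := fun _ => BitTrie → ℕ → ℕ) (fun _ n => n)
    (fun r _ ih t n => reduceThen (nat_lit 12000) t n r ih) rows

/-- The row of the `c`-th unit vector. The tag is the product of `c` and an odd multiplier close
to `2^64` divided by the golden ratio, which spreads the tags evenly. -/
def unitRow (c : ℕ) : ℕ :=
  withValue c fun c => Nat.add (Nat.shiftLeft (nat_lit 1) (Nat.add c (nat_lit 64)))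
    (Nat.mod (Nat.mul c (nat_lit 11400714819323198485)) (nat_lit 18446744073709551616))

/-- Adds the coefficient of `T^k` in `z^c (z^a + z^b T)^n` to the row `acc`. The binomial
coefficient `C(n, k)` is odd if and only if the binary digits of `k` are among those of `n`. -/
def lastStep (n a b : ℕ) : ℕ → ℕ → ℕ → ℕ := fun k c acc =>
  ifTrue (Nat.beq (Nat.land n k) k)
    (Nat.xor acc (unitRow (Nat.add (Nat.add c (Nat.mul a (Nat.sub n k))) (Nat.mul b k)))) acc

/-- Multiplies by a factor `(z^a + z^b T)^n`: if `next k c acc` adds the coefficient of `T^k` in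
`z^c G` to `acc`, then this adds the coefficient of `T^k` in `z^c (z^a + z^b T)^n G`. -/
def factorStep (n a b : ℕ) (next : ℕ → ℕ → ℕ → ℕ) : ℕ → ℕ → ℕ → ℕ := fun k c acc =>
  Nat.rec (motive := fun _ => ℕ) (next k (Nat.add c (Nat.mul a n)) acc)
    (fun m ih => ifTrue (Nat.beq (Nat.land n (Nat.succ m)) (Nat.succ m))
      (next (Nat.sub k (Nat.succ m))
        (Nat.add (Nat.add c (Nat.mul a (Nat.sub n (Nat.succ m)))) (Nat.mul b (Nat.succ m)))
        ih) ih) k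

/-- The row of the twisted square with exponent `k` of the monomial with exponents `v0, …, v4`,
under the substitution `y_j ↦ z^{c_j}` with `c = (89, 360, 382, 0, 59)`. The factor belonging to
`y_j` is `(z^a + z^b T)^{v_j}` with `a = c_j` and `b = 2 c_{j-1}`. -/
def sqRow (k v0 v1 v2 v3 v4 : ℕ) : ℕ :=
  factorStep v0 (nat_lit 89) (nat_lit 118)
    (factorStep v1 (nat_lit 360) (nat_lit 178)
      (factorStep v2 (nat_lit 382) (nat_lit 720)
        (factorStep v4 (nat_lit 59) (nat_lit 0)
          (lastStep v3 (nat_lit 0) (nat_lit 764))))) k (nat_lit 0) (nat_lit 0)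

/-- Applies `f 0, f 1, …, f n`, each of which prepends to a list, with `f n` acting first. -/
def prependUpTo {α : Type} (n : ℕ) (f : ℕ → List α → List α) (tl : List α) : List α :=
  Nat.rec (motive := fun _ => ℕ → List α) (fun i => f i tl)
    (fun _ ih i => f i (ih (Nat.succ i))) n (nat_lit 0)

/-- Prepends `a` if the condition holds. -/
def prependIf {α : Type} (b : Bool) (a : α) (tl : List α) : List α :=
  ifTrue b (List.cons a tl) tl

/-- Prepends the values of `f` at all exponent vectors of degree `n` and weight `w`. Given `v0`,
`v1`, `v2` and `s = v3 + v4`, the weight is `v0 + 2 v1 + 4 v2 + 8 s + 8 v4`, which determines `v4`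
modulo `31`, as `4 * 8 = 1` in `ZMod 31`. The multiple `620` of `31` keeps the truncated
subtraction honest, and for `n ≤ 31` only the two least values of `v4` are possible. -/
def blockExponents {α : Type} (w n : ℕ) (f : ℕ → ℕ → ℕ → ℕ → ℕ → α) : List α → List α :=
  prependUpTo n fun v2 => prependUpTo (Nat.sub n v2) fun v0 =>
    prependUpTo (Nat.sub (Nat.sub n v2) v0) fun v1 tl =>
      withValue (Nat.sub (Nat.sub (Nat.sub n v2) v0) v1) fun s =>
      withValue (Nat.mod (Nat.mul (nat_lit 4) (Nat.sub (Nat.add w (nat_lit 620))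
        (Nat.add (Nat.add (Nat.add v0 (Nat.mul (nat_lit 2) v1)) (Nat.mul (nat_lit 4) v2))
          (Nat.mul (nat_lit 8) s)))) (nat_lit 31)) fun v4 =>
      prependIf (Nat.ble v4 s) (f v0 v1 v2 (Nat.sub s v4) v4)
        (prependIf (Nat.ble (Nat.add v4 (nat_lit 31)) s)
          (f v0 v1 v2 (Nat.sub s (Nat.add v4 (nat_lit 31))) (Nat.add v4 (nat_lit 31))) tl)

/-- The rows of the squares with exponents `1, 2, 4, 8, 16` of the monomials of weight `w` and
degrees `30, 29, 27, 23, 15`. -/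
def blockRows (w : ℕ) : List ℕ :=
  blockExponents w (nat_lit 30) (sqRow (nat_lit 1))
    (blockExponents w (nat_lit 29) (sqRow (nat_lit 2))
      (blockExponents w (nat_lit 27) (sqRow (nat_lit 4))
        (blockExponents w (nat_lit 23) (sqRow (nat_lit 8))
          (blockExponents w (nat_lit 15) (sqRow (nat_lit 16)) List.nil))))

/-- The rank of the block of weight `w`. -/
def blockRank (w : ℕ) : ℕ := eliminate (blockRows w) (BitTrie.zero (nat_lit 14)) (nat_lit 0)

/-- The exponent of `z` in the image of a monomial under `y_j ↦ z^{c_j}`. The exponents `c_j` are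
small and chosen such that monomials of degree `31` and equal weight have different codes. -/
def monomialCode (v0 v1 v2 _v3 v4 : ℕ) : ℕ :=
  Nat.add (Nat.add (Nat.add (Nat.mul (nat_lit 89) v0) (Nat.mul (nat_lit 360) v1))
    (Nat.mul (nat_lit 382) v2)) (Nat.mul (nat_lit 59) v4)

/-- Whether the numbers in the list are distinct and avoid the nonzero bits of `m`. -/
def distinctBits (l : List ℕ) : ℕ → Bool :=
  List.rec (motive := fun _ => ℕ → Bool) (fun _ => true)
    (fun c _ ih m => ifTrue (Nat.beq (Nat.mod (Nat.shiftRight m c) (nat_lit 2)) (nat_lit 0))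
      (withValue (Nat.lor m (Nat.shiftLeft (nat_lit 1) c)) ih) false) l

/-- Whether the monomials of degree `31` and weight `w` have different codes. -/
def blockCodesDistinct (w : ℕ) : Bool :=
  distinctBits (blockExponents w (nat_lit 31) monomialCode List.nil) (nat_lit 0)

end

/-! ### Correctness of the elimination -/

theorem withValue_eq {α : Type} (n : ℕ) (f : ℕ → α) : withValue n f = f n := by
  cases n <;> rfl

theorem ifTrue_eq {α : Type} (c : Bool) (a b : α) : ifTrue c a b = if c then a else b := by
  cases c <;> rfl

namespace BitTrie

/-- All leaves of the tree are at depth `d`. -/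
def IsPerfect : ℕ → BitTrie → Prop
  | 0, leaf _ => True
  | d + 1, node l r => IsPerfect d l ∧ IsPerfect d r
  | _, _ => False

theorem get_node (l r : BitTrie) (i : ℕ) :
    (node l r).get i = if i % 2 = 0 then l.get (i / 2) else r.get (i / 2) := by
  change Nat.rec (motive := fun _ => ℕ) (l.get (i / 2)) (fun _ _ => r.get (i / 2)) (i % 2) = _
  rcases Nat.mod_two_eq_zero_or_one i with h | h <;> simp [h]

theorem setThen_node (l r : BitTrie) (i v : ℕ) (k : BitTrie → ℕ) :
    (node l r).setThen i v k = if i % 2 = 0 then l.setThen (i / 2) v (fun l' => k (node l' r))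
      else r.setThen (i / 2) v (fun r' => k (node l r')) := by
  change Nat.rec (motive := fun _ => ℕ) (l.setThen (i / 2) v fun l' => k (node l' r))
    (fun _ _ => r.setThen (i / 2) v fun r' => k (node l r')) (i % 2) = _
  rcases Nat.mod_two_eq_zero_or_one i with h | h <;> simp [h]

theorem exists_setThen_eq {d : ℕ} {t : BitTrie} (ht : t.IsPerfect d) {i : ℕ} (hi : i < 2 ^ d)
    (v : ℕ) : ∃ t' : BitTrie, t'.IsPerfect d ∧ (∀ k, t.setThen i v k = k t') ∧
      ∀ j < 2 ^ d, t'.get j = if j = i then v else t.get j := by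
  induction d generalizing t i with
  | zero =>
    cases t with
    | leaf u =>
      refine ⟨leaf v, trivial, fun _ => rfl, fun j hj => ?_⟩
      rw [if_pos (by omega)]
      rfl
    | node l r => exact ht.elim
  | succ d ih =>
    cases t with
    | leaf u => exact ht.elim
    | node l r =>
      rw [pow_succ] at hi
      rcases Nat.mod_two_eq_zero_or_one i with h | h
      · obtain ⟨l', hl', hset, hget⟩ := ih ht.1 (i := i / 2) (by omega)
        refine ⟨node l' r, ⟨hl', ht.2⟩, fun k => ?_, fun j hj => ?_⟩
        · rw [setThen_node, if_pos h, hset]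
        · rw [pow_succ] at hj
          rw [get_node, get_node, hget _ (by omega)]
          split_ifs <;> first | rfl | omega
      · obtain ⟨r', hr', hset, hget⟩ := ih ht.2 (i := i / 2) (by omega)
        refine ⟨node l r', ⟨ht.1, hr'⟩, fun k => ?_, fun j hj => ?_⟩
        · rw [setThen_node, if_neg (by omega), hset]
        · rw [pow_succ] at hj
          rw [get_node, get_node, hget _ (by omega)]
          split_ifs <;> first | rfl | omega

theorem isPerfect_zero (d : ℕ) : (zero d).IsPerfect d := by
  induction d with
  | zero => trivial
  | succ d ih => exact ⟨ih, ih⟩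

theorem get_zero (d i : ℕ) : (zero d).get i = 0 := by
  induction d generalizing i with
  | zero => rfl
  | succ d ih =>
    change (node (zero d) (zero d)).get i = 0
    rw [get_node, ih, ite_self]

end BitTrie

/-- The vector of a row. -/
def rowVec (r : ℕ) : ℕ → ZMod 2 := fun i => if (r >>> 64).testBit i then 1 else 0

theorem rowVec_xor (a b : ℕ) : rowVec (Nat.xor a b) = rowVec a + rowVec b := by
  funext i
  change (if ((a ^^^ b) >>> 64).testBit i then 1 else 0 : ZMod 2) =
    (if (a >>> 64).testBit i then 1 else 0 : ZMod 2) +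
      (if (b >>> 64).testBit i then 1 else 0 : ZMod 2)
  rw [Nat.shiftRight_xor_distrib, Nat.testBit_xor]
  cases (a >>> 64).testBit i <;> cases (b >>> 64).testBit i <;> decide

theorem rowVec_of_shiftRight_eq_zero {r : ℕ} (h : r >>> 64 = 0) : rowVec r = 0 := by
  funext i
  simp [rowVec, h]

theorem exists_lowest_bit {s : ℕ} (hs : s ≠ 0) :
    ∃ l, s.testBit l = true ∧ (∀ j < l, s.testBit j = false) ∧ s ^^^ (s - 1) = 2 ^ (l + 1) - 1 := by
  induction s using Nat.strong_induction_on with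
  | _ s ih =>
    obtain ⟨m, rfl | rfl⟩ := Nat.even_or_odd' s
    · obtain ⟨l, h1, h2, h3⟩ := ih m (by omega) (by omega)
      refine ⟨l + 1, ?_, ?_, ?_⟩
      · rw [Nat.testBit_succ, Nat.mul_div_cancel_left _ two_pos, h1]
      · rintro (_ | j) hj
        · simp
        · rw [Nat.testBit_succ, Nat.mul_div_cancel_left _ two_pos, h2 j (by omega)]
      · have e := Nat.xor_bit false m true (m - 1)
        simp only [Nat.bit_false, Nat.bit_true] at e
        rw [show 2 * m - 1 = 2 * (m - 1) + 1 by omega, e]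
        simp only [bne, Nat.bit, h3]
        have := Nat.one_le_two_pow (n := l + 1)
        rw [pow_succ 2 (l + 1)]
        simp
        omega
    · refine ⟨0, by simp, by simp, ?_⟩
      have e := Nat.xor_bit true m false m
      simp only [Nat.bit_false, Nat.bit_true] at e
      rw [show 2 * m + 1 - 1 = 2 * m by omega, e]
      simp

/-- The lowest nonzero entry of the vector `x` is at position `l`. -/
def IsLowest (x : ℕ → ZMod 2) (l : ℕ) : Prop := x l = 1 ∧ ∀ j < l, x j = 0

theorem exists_isLowest_rowVec {r : ℕ} (h : r >>> 64 ≠ 0) :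
    ∃ l, IsLowest (rowVec r) l ∧ pivotKey r = (2 ^ (l + 1) - 1) % 11867 := by
  obtain ⟨l, h1, h2, h3⟩ := exists_lowest_bit h
  refine ⟨l, ⟨by simp [rowVec, h1], fun j hj => by simp [rowVec, h2 j hj]⟩, ?_⟩
  rw [← h3]
  rfl

/-- In a sum of vectors with different lowest positions, the least of these is not cancelled. -/
theorem exists_isLowest_sum {I : Finset ℕ} {l : ℕ → ℕ} {x : ℕ → ℕ → ZMod 2}
    (hI : I.Nonempty) (hl : ∀ c ∈ I, IsLowest (x c) (l c)) (hinj : Set.InjOn l I) :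
    ∃ c ∈ I, IsLowest (∑ c ∈ I, x c) (l c) := by
  obtain ⟨c, hc, hmin⟩ := Finset.exists_min_image I l hI
  refine ⟨c, hc, ?_, fun j hj => ?_⟩
  · rw [Finset.sum_apply, Finset.sum_eq_single_of_mem c hc, (hl c hc).1]
    intro b hb hbc
    exact (hl b hb).2 _ (lt_of_le_of_ne (hmin b hb) fun e => hbc (hinj hb hc e.symm))
  · rw [Finset.sum_apply]
    exact Finset.sum_eq_zero fun b hb => (hl b hb).2 j (hj.trans_le (hmin b hb))

/-- The invariant of the elimination: the tree holds precisely the rows in `I`, each at its key.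
Since the key is a function of the lowest position, the rows in `I` have different lowest
positions. -/
structure IsEchelon (t : BitTrie) (I : Finset ℕ) : Prop where
  isPerfect : t.IsPerfect 14
  ne_zero : ∀ c ∈ I, c >>> 64 ≠ 0
  get_pivotKey : ∀ c ∈ I, t.get (pivotKey c) = c
  mem_of_get : ∀ i < 2 ^ 14, t.get i ≠ 0 → t.get i ∈ I

theorem pivotKey_lt (r : ℕ) : pivotKey r < 2 ^ 14 :=
  (Nat.mod_lt _ (by norm_num)).trans (by norm_num)

theorem IsEchelon.exists_lowest {t : BitTrie} {I : Finset ℕ} (h : IsEchelon t I) :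
    ∃ l : ℕ → ℕ, (∀ c ∈ I, IsLowest (rowVec c) (l c) ∧ pivotKey c = (2 ^ (l c + 1) - 1) % 11867) ∧
      Set.InjOn l I := by
  choose! l hl using fun c (hc : c ∈ I) => exists_isLowest_rowVec (h.ne_zero c hc)
  refine ⟨l, hl, fun a ha b hb hab => ?_⟩
  rw [← h.get_pivotKey a ha, ← h.get_pivotKey b hb, (hl a ha).2, (hl b hb).2, hab]

theorem IsEchelon.finrank_span {t : BitTrie} {I : Finset ℕ} (h : IsEchelon t I) :
    Module.finrank (ZMod 2) (Submodule.span (ZMod 2) (rowVec '' I)) = I.card := by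
  obtain ⟨l, hl, hinj⟩ := h.exists_lowest
  have hli : LinearIndependent (ZMod 2) fun c : I => rowVec c := by
    classical
    rw [linearIndependent_iff']
    intro s g hg
    by_contra! hne
    obtain ⟨c, hc, hgc⟩ := hne
    obtain ⟨d, -, hd⟩ := exists_isLowest_sum (I := (s.filter fun c => g c ≠ 0).map
      (Function.Embedding.subtype _)) (l := l) (x := rowVec)
      ⟨c, Finset.mem_map.mpr ⟨c, Finset.mem_filter.mpr ⟨hc, hgc⟩, rfl⟩⟩
      (fun c hc => by
        obtain ⟨c, -, rfl⟩ := Finset.mem_map.mp hc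
        exact (hl c c.2).1)
      (hinj.mono fun c hc => by
        obtain ⟨c, -, rfl⟩ := Finset.mem_map.mp hc
        exact c.2)
    have e : ∑ c ∈ (s.filter fun c => g c ≠ 0).map (Function.Embedding.subtype _),
        rowVec c = 0 := by
      rw [← hg, Finset.sum_map, Finset.sum_filter]
      refine Finset.sum_congr rfl fun c _ => ?_
      split_ifs with h
      · have h1 : g c = 1 := Fin.eq_one_of_ne_zero _ h
        rw [h1, one_smul]
        rfl
      · rw [not_not.mp h, zero_smul]
    rw [e] at hd
    exact zero_ne_one hd.1
  have := finrank_span_eq_card hli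
  rw [Fintype.card_coe] at this
  rw [Set.image_eq_range]
  exact this

theorem IsEchelon.insert {t : BitTrie} {I : Finset ℕ} (h : IsEchelon t I) {r : ℕ}
    (hr : r >>> 64 ≠ 0) (hget : t.get (pivotKey r) = 0) :
    ∃ t', (∀ k, t.setThen (pivotKey r) r k = k t') ∧ r ∉ I ∧ IsEchelon t' (insert r I) := by
  obtain ⟨t', ht', hset, hget'⟩ := BitTrie.exists_setThen_eq h.isPerfect (pivotKey_lt r) r
  have hr0 : r ≠ 0 := by rintro rfl; exact hr (by simp)
  have hne : ∀ c ∈ I, pivotKey c ≠ pivotKey r := fun c hc e => by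
    have := h.get_pivotKey c hc
    rw [e, hget] at this
    subst this
    exact h.ne_zero 0 hc (by simp)
  refine ⟨t', hset, fun hmem => hne r hmem rfl, ht', ?_, ?_, ?_⟩
  · intro c hc
    rcases Finset.mem_insert.mp hc with rfl | hc
    · exact hr
    · exact h.ne_zero c hc
  · intro c hc
    rw [hget' _ (pivotKey_lt c)]
    rcases Finset.mem_insert.mp hc with rfl | hc
    · rw [if_pos rfl]
    · rw [if_neg (hne c hc), h.get_pivotKey c hc]
  · intro i hi h0
    rw [hget' i hi] at h0 ⊢
    split_ifs at h0 ⊢ with hir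
    · exact Finset.mem_insert_self _ _
    · exact Finset.mem_insert_of_mem (h.mem_of_get i hi h0)

theorem reduceThen_succ (fuel : ℕ) (t : BitTrie) (n r : ℕ) (k : BitTrie → ℕ → ℕ) :
    reduceThen (fuel + 1) t n r k = if r >>> 64 = 0 then k t n else
      if t.get (pivotKey r) = 0 then t.setThen (pivotKey r) r fun t' => k t' (n + 1)
      else reduceThen fuel t n (Nat.xor r (t.get (pivotKey r))) k := by
  change withValue r (fun r => Nat.rec (motive := fun _ => ℕ) (k t n)
      (fun _ _ => withValue (pivotKey r) fun i => withValue (t.get i) fun p =>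
        Nat.rec (motive := fun _ => ℕ) (t.setThen i r fun t' => withValue (n + 1) (k t'))
          (fun _ _ => reduceThen fuel t n (Nat.xor r p) k) p) (r >>> 64)) = _
  simp only [withValue_eq]
  rcases hr : r >>> 64 with _ | m
  · simp
  · rcases hp : t.get (pivotKey r) with _ | p
    · simp
    · simp

/-- Adding a stored row to `r` does not change the span, whatever row that is. So the only
hypothesis needed is that the fuel does not run out. -/
theorem exists_reduceThen_eq {fuel : ℕ} {t : BitTrie} {I : Finset ℕ} (h : IsEchelon t I) (r : ℕ)
    {k : BitTrie → ℕ → ℕ} (hk : reduceThen fuel t I.card r k ≠ 0) :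
    ∃ t' I', IsEchelon t' I' ∧ reduceThen fuel t I.card r k = k t' I'.card ∧
      Submodule.span (ZMod 2) (rowVec '' I') =
        Submodule.span (ZMod 2) (insert (rowVec r) (rowVec '' I)) := by
  induction fuel generalizing r with
  | zero => exact absurd rfl hk
  | succ fuel ih =>
    rw [reduceThen_succ] at hk ⊢
    split_ifs at hk ⊢ with hr hget
    · refine ⟨t, I, h, rfl, ?_⟩
      rw [rowVec_of_shiftRight_eq_zero hr, Submodule.span_insert_zero]
    · obtain ⟨t', hset, hrI, ht'⟩ := h.insert hr hget
      refine ⟨t', insert r I, ht', ?_, ?_⟩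
      · rw [hset, Finset.card_insert_of_notMem hrI]
      · rw [Finset.coe_insert, Set.image_insert_eq]
    · obtain ⟨t', I', ht', he, hs⟩ := ih _ hk
      refine ⟨t', I', ht', he, hs.trans ?_⟩
      have hp : rowVec (t.get (pivotKey r)) ∈ Submodule.span (ZMod 2) (rowVec '' I) :=
        Submodule.subset_span ⟨_, h.mem_of_get _ (pivotKey_lt r) hget, rfl⟩
      rw [rowVec_xor, Submodule.span_insert, Submodule.span_insert]
      apply le_antisymm
      · refine sup_le ?_ le_sup_right
        rw [Submodule.span_singleton_le_iff_mem]
        exact Submodule.add_mem_sup (Submodule.mem_span_singleton_self _) hp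
      · refine sup_le ?_ le_sup_right
        rw [Submodule.span_singleton_le_iff_mem]
        have := Submodule.sub_mem_sup (Submodule.mem_span_singleton_self (R := ZMod 2)
          (rowVec r + rowVec (t.get (pivotKey r)))) hp
        rwa [add_sub_cancel_right] at this

theorem eliminate_eq_finrank {rows : List ℕ} {t : BitTrie} {I : Finset ℕ} (h : IsEchelon t I)
    (h0 : eliminate rows t I.card ≠ 0) :
    eliminate rows t I.card = Module.finrank (ZMod 2)
      (Submodule.span (ZMod 2) (rowVec '' {r | r ∈ rows ∨ r ∈ I})) := by
  induction rows generalizing t I with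
  | nil =>
    have e : {r | r ∈ ([] : List ℕ) ∨ r ∈ I} = (I : Set ℕ) := by
      ext r
      simp
    rw [e, h.finrank_span]
    rfl
  | cons r rows ih =>
    obtain ⟨t', I', ht', he, hs⟩ := exists_reduceThen_eq (fuel := nat_lit 12000) h r
      (k := eliminate rows) h0
    have he : eliminate (r :: rows) t I.card = eliminate rows t' I'.card := he
    rw [he] at h0 ⊢
    rw [ih ht' h0]
    have e1 : rowVec '' {r | r ∈ rows ∨ r ∈ I'} = rowVec '' {r | r ∈ rows} ∪ rowVec '' I' := by
      rw [← Set.image_union]; rfl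
    have e2 : rowVec '' {s | s ∈ r :: rows ∨ s ∈ I} =
        rowVec '' {r | r ∈ rows} ∪ insert (rowVec r) (rowVec '' I) := by
      rw [← Set.image_insert_eq, ← Set.image_union]
      congr 1
      ext s
      simp only [List.mem_cons, Set.mem_union, Set.mem_ofPred_eq, Set.mem_insert_iff,
        Finset.mem_coe]
      tauto
    rw [e1, e2, Submodule.span_union, Submodule.span_union, hs]

/-- A nonzero result of the elimination is the dimension of the span of the rows. -/
theorem eliminate_zero_eq_finrank {rows : List ℕ} (h0 : eliminate rows (BitTrie.zero 14) 0 ≠ 0) :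
    eliminate rows (BitTrie.zero 14) 0 = Module.finrank (ZMod 2)
      (Submodule.span (ZMod 2) (rowVec '' {r | r ∈ rows})) := by
  have h : IsEchelon (BitTrie.zero 14) ∅ :=
    { isPerfect := BitTrie.isPerfect_zero 14
      ne_zero := by simp
      get_pivotKey := by simp
      mem_of_get := fun i _ hi => absurd (BitTrie.get_zero 14 i) hi }
  have e : {r | r ∈ rows ∨ r ∈ (∅ : Finset ℕ)} = {r | r ∈ rows} := by
    ext r
    simp
  rw [← e]
  exact eliminate_eq_finrank h h0

/-! ### Correctness of the rows -/

/-- Lucas' theorem modulo two. -/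
theorem natCast_choose_zmod_two (n i : ℕ) :
    ((n.choose i : ℕ) : ZMod 2) = if n &&& i = i then 1 else 0 := by
  induction n using Nat.strong_induction_on generalizing i with
  | _ n ih =>
    rcases Nat.eq_zero_or_pos n with rfl | hn
    · rcases Nat.eq_zero_or_pos i with rfl | hi
      · simp
      · rw [Nat.choose_eq_zero_of_lt hi, Nat.zero_and, if_neg hi.ne, Nat.cast_zero]
    · have h := (ZMod.natCast_eq_natCast_iff _ _ 2).mpr
        (Choose.choose_modEq_choose_mod_mul_choose_div_nat (n := n) (k := i) (p := 2))
      rw [h, Nat.cast_mul, ih (n / 2) (by omega) (i / 2)]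
      have hiff : n &&& i = i ↔ (n % 2 &&& i % 2 = i % 2) ∧ (n / 2 &&& i / 2 = i / 2) := by
        have h1 : (n &&& i) % 2 = n % 2 &&& i % 2 := Nat.and_mod_two_pow (n := 1)
        have h2 : (n &&& i) / 2 = n / 2 &&& i / 2 := Nat.and_div_two_pow (n := 1)
        rw [← h1, ← h2]
        omega
      simp only [hiff]
      rcases Nat.mod_two_eq_zero_or_one n with h1 | h1 <;>
        rcases Nat.mod_two_eq_zero_or_one i with h2 | h2 <;> simp [h1, h2]

open Polynomial in
/-- The polynomial `(z^a + z^b T)^n` in `T`. -/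
noncomputable def factor (n a b : ℕ) : (ZMod 2)[X][X] := (C (X ^ a) + C (X ^ b) * X) ^ n

open Polynomial in
theorem coeff_factor (n a b i : ℕ) : (factor n a b).coeff i =
    if n &&& i = i then X ^ (a * (n - i) + b * i) else 0 := by
  have e : factor n a b = ∑ m ∈ Finset.range (n + 1),
      C (X ^ (b * m) * X ^ (a * (n - m)) * ((n.choose m : ℕ) : (ZMod 2)[X])) * X ^ m := by
    rw [factor, add_comm, add_pow]
    refine Finset.sum_congr rfl fun m _ => ?_
    simp only [mul_pow, map_mul, map_pow, map_natCast, ← pow_mul]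
    ring
  have hc : ((n.choose i : ℕ) : (ZMod 2)[X]) = if n &&& i = i then 1 else 0 := by
    rw [← Polynomial.C_eq_natCast, natCast_choose_zmod_two]
    split_ifs <;> simp
  rw [e, finsetSum_coeff]
  simp only [coeff_C_mul, coeff_X_pow]
  rcases le_or_gt i n with h | h
  · rw [Finset.sum_eq_single_of_mem i (by simpa [Nat.lt_succ_iff] using h)
      (fun m _ hm => by rw [if_neg hm.symm, mul_zero]), hc]
    split_ifs <;> simp_all [pow_add, mul_comm]
  · rw [Finset.sum_eq_zero, if_neg]
    · intro hi
      have := Nat.and_le_left (n := n) (m := i)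
      omega
    · intro m hm
      rw [if_neg, mul_zero]
      have := Finset.mem_range.mp hm
      omega

theorem rowVec_unitRow (c : ℕ) :
    rowVec (unitRow c) = (Polynomial.X ^ c : Polynomial (ZMod 2)).coeff := by
  have h : unitRow c = 2 ^ (c + 64) + c * 11400714819323198485 % 2 ^ 64 := by
    rw [unitRow, withValue_eq]
    change 1 <<< (c + 64) + _ = _
    rw [Nat.one_shiftLeft]
    rfl
  have h2 : unitRow c >>> 64 = 2 ^ c := by
    rw [h, Nat.shiftRight_eq_div_pow, pow_add, mul_comm, Nat.mul_add_div (by positivity),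
      Nat.div_eq_of_lt (Nat.mod_lt _ (by positivity)), add_zero]
  funext i
  rw [rowVec, h2, Nat.testBit_two_pow, Polynomial.coeff_X_pow]
  by_cases h : c = i
  · simp [h]
  · simp [h, Ne.symm h]

/-- The program `next` adds the coefficient of `T^k` in `z^c G` to the row `acc`. -/
def AddsCoeff (next : ℕ → ℕ → ℕ → ℕ) (G : Polynomial (Polynomial (ZMod 2))) : Prop :=
  ∀ k c acc, rowVec (next k c acc) = rowVec acc + (G.coeff k * Polynomial.X ^ c).coeff

theorem addsCoeff_lastStep (n a b : ℕ) : AddsCoeff (lastStep n a b) (factor n a b) := by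
  intro k c acc
  rw [lastStep, ifTrue_eq, coeff_factor]
  simp only [Nat.beq_eq]
  change rowVec (if n &&& k = k then _ else _) = _
  split_ifs
  · rw [rowVec_xor, rowVec_unitRow]
    change rowVec acc + (Polynomial.X ^ (c + a * (n - k) + b * k) : Polynomial (ZMod 2)).coeff = _
    rw [← pow_add, show c + a * (n - k) + b * k = a * (n - k) + b * k + c by ring]
  · funext i
    simp

theorem AddsCoeff.factorStep {next : ℕ → ℕ → ℕ → ℕ} {G : Polynomial (Polynomial (ZMod 2))}
    (h : AddsCoeff next G) (n a b : ℕ) :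
    AddsCoeff (factorStep n a b next) (factor n a b * G) := by
  intro k c acc
  have key : ∀ m, rowVec (Nat.rec (motive := fun _ => ℕ) (next k (c + a * n) acc)
      (fun m ih => ifTrue (Nat.beq (Nat.land n (m + 1)) (m + 1))
        (next (k - (m + 1)) (c + a * (n - (m + 1)) + b * (m + 1)) ih) ih) m) =
      rowVec acc + ((∑ i ∈ Finset.range (m + 1), (factor n a b).coeff i * G.coeff (k - i)) *
        Polynomial.X ^ c).coeff := by
    intro m
    induction m with
    | zero =>
      rw [Finset.sum_range_one, coeff_factor, if_pos (by simp)]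
      change rowVec (next k (c + a * n) acc) = _
      rw [h]
      congr 2
      simp only [Nat.sub_zero, mul_zero, add_zero]
      ring
    | succ m ih =>
      change rowVec (ifTrue _ _ _) = _
      rw [ifTrue_eq, Finset.sum_range_succ, add_mul, coeff_factor]
      simp only [Nat.beq_eq]
      change rowVec (if n &&& (m + 1) = m + 1 then _ else _) = _
      have hadd : ∀ p q : Polynomial (ZMod 2), (p + q).coeff = p.coeff + q.coeff := fun p q =>
        funext fun i => Polynomial.coeff_add p q i
      split_ifs
      · rw [h, ih, hadd, add_assoc]
        congr 3
        ring
      · rw [ih, zero_mul, zero_mul, add_zero]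
  rw [Polynomial.coeff_mul, Finset.Nat.sum_antidiagonal_eq_sum_range_succ_mk]
  exact key k

section Code
open MvPolynomial

/-- The exponents `c_j` of the substitution `y_j ↦ z^{c_j}`. -/
def codeExponent : Fin 5 → ℕ := ![89, 360, 382, 0, 59]

/-- The substitution `y_j ↦ z^{c_j}`. -/
noncomputable def codeHom : P 5 →ₐ[ZMod 2] Polynomial (ZMod 2) :=
  aeval fun j => Polynomial.X ^ codeExponent j

theorem codeHom_monomial (v : Fin 5 →₀ ℕ) : codeHom (monomial v 1) =
    Polynomial.X ^ monomialCode (v 0) (v 1) (v 2) (v 3) (v 4) := by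
  rw [codeHom, aeval_monomial, map_one, one_mul, Finsupp.prod_fintype _ _ (fun _ => pow_zero _),
    Fin.prod_univ_five]
  simp only [← pow_mul, ← pow_add]
  congr 1
  simp [codeExponent, monomialCode]

theorem map_codeHom_twistedTotalSq (v : Fin 5 →₀ ℕ) :
    Polynomial.mapRingHom codeHom.toRingHom (twistedTotalSq (ZMod 2) cyc (monomial v 1)) =
      factor (v 0) 89 118 * (factor (v 1) 360 178 * (factor (v 2) 382 720 *
        (factor (v 4) 59 0 * factor (v 3) 0 764))) := by
  have hX : ∀ j, Polynomial.mapRingHom codeHom.toRingHom (twistedTotalSq (ZMod 2) cyc (X j)) =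
      Polynomial.C (Polynomial.X ^ codeExponent j) +
        Polynomial.C (Polynomial.X ^ (2 * codeExponent (cyc j))) * Polynomial.X := by
    intro j
    simp [twistedTotalSq, codeHom, pow_mul']
  rw [monomial_eq, C_1, one_mul, Finsupp.prod_fintype _ _ (fun _ => pow_zero _)]
  simp only [map_prod, map_pow, hX]
  rw [Fin.prod_univ_five]
  simp only [factor]
  have h0 : 2 * codeExponent (cyc 0) = 118 := rfl
  have h1 : 2 * codeExponent (cyc 1) = 178 := rfl
  have h2 : 2 * codeExponent (cyc 2) = 720 := rfl
  have h3 : 2 * codeExponent (cyc 3) = 764 := rfl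
  have h4 : 2 * codeExponent (cyc 4) = 0 := rfl
  rw [h0, h1, h2, h3, h4]
  simp only [codeExponent]
  simp
  ring

/-- The vector of coefficients of the image of a polynomial under the substitution
`y_j ↦ z^{c_j}`. -/
noncomputable def codeVec : P 5 →ₗ[ZMod 2] ℕ → ZMod 2 :=
  (LinearMap.pi fun n => Polynomial.lcoeff (ZMod 2) n).comp codeHom.toLinearMap

theorem codeVec_apply (f : P 5) : codeVec f = (codeHom f).coeff := rfl

theorem rowVec_sqRow (k : ℕ) (v : Fin 5 →₀ ℕ) : rowVec (sqRow k (v 0) (v 1) (v 2) (v 3) (v 4)) =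
    codeVec (twistedSq (ZMod 2) cyc k (monomial v 1)) := by
  have h := ((((addsCoeff_lastStep (v 3) 0 764).factorStep (v 4) 59 0).factorStep (v 2)
    382 720).factorStep (v 1) 360 178).factorStep (v 0) 89 118
  rw [← map_codeHom_twistedTotalSq] at h
  refine (h k 0 0).trans ?_
  rw [rowVec_of_shiftRight_eq_zero (Nat.zero_shiftRight _), zero_add, pow_zero, mul_one,
    codeVec_apply, twistedSq_apply]
  simp

end Code

/-! ### The rows of a block -/

theorem mem_prependUpTo {α : Type} {f : ℕ → List α → List α} {p : ℕ → Prop} {x : α}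
    (h : ∀ i tl, x ∈ f i tl ↔ p i ∨ x ∈ tl) (n : ℕ) (tl : List α) :
    x ∈ prependUpTo n f tl ↔ (∃ i ≤ n, p i) ∨ x ∈ tl := by
  have key : ∀ n i, x ∈ Nat.rec (motive := fun _ => ℕ → List α) (fun i => f i tl)
      (fun _ ih i => f i (ih (Nat.succ i))) n i ↔ (∃ j, i ≤ j ∧ j ≤ i + n ∧ p j) ∨ x ∈ tl := by
    intro n
    induction n with
    | zero =>
      intro i
      change x ∈ f i tl ↔ _
      rw [h, or_congr_left]
      constructor
      · exact fun hp => ⟨i, le_rfl, le_rfl, hp⟩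
      · rintro ⟨j, h1, h2, hp⟩
        rwa [show i = j by omega]
    | succ n ih =>
      intro i
      change x ∈ f i _ ↔ _
      rw [h, ih, ← or_assoc, or_congr_left]
      constructor
      · rintro (hp | ⟨j, h1, h2, hp⟩)
        · exact ⟨i, le_rfl, by omega, hp⟩
        · exact ⟨j, by omega, by omega, hp⟩
      · rintro ⟨j, h1, h2, hp⟩
        rcases h1.eq_or_lt with rfl | h1
        · exact Or.inl hp
        · exact Or.inr ⟨j, h1, by omega, hp⟩
  refine (key n 0).trans (or_congr_left ?_)
  simp

theorem mem_prependIf {α : Type} (b : Bool) (a x : α) (tl : List α) :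
    x ∈ prependIf b a tl ↔ (b = true ∧ a = x) ∨ x ∈ tl := by
  cases b
  · simp [prependIf, ifTrue]
  · simp [prependIf, ifTrue, eq_comm]

theorem mem_blockExponents {α : Type} {w n : ℕ} (hw : w < 31) (hn : n ≤ 31)
    (f : ℕ → ℕ → ℕ → ℕ → ℕ → α) (tl : List α) (x : α) : x ∈ blockExponents w n f tl ↔
      (∃ v0 v1 v2 v3 v4, v0 + v1 + v2 + v3 + v4 = n ∧
        (v0 + 2 * v1 + 4 * v2 + 8 * v3 + 16 * v4) % 31 = w ∧ f v0 v1 v2 v3 v4 = x) ∨ x ∈ tl := by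
  have inner : ∀ v0 v1 v2 s : ℕ, ∀ tl : List α,
      x ∈ withValue (4 * (w + 620 - (v0 + 2 * v1 + 4 * v2 + 8 * s)) % 31) (fun v4 =>
        prependIf (Nat.ble v4 s) (f v0 v1 v2 (s - v4) v4)
          (prependIf (Nat.ble (v4 + 31) s) (f v0 v1 v2 (s - (v4 + 31)) (v4 + 31)) tl)) ↔
      (∃ v4, (v4 = 4 * (w + 620 - (v0 + 2 * v1 + 4 * v2 + 8 * s)) % 31 ∨
        v4 = 4 * (w + 620 - (v0 + 2 * v1 + 4 * v2 + 8 * s)) % 31 + 31) ∧ v4 ≤ s ∧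
        f v0 v1 v2 (s - v4) v4 = x) ∨ x ∈ tl := by
    intro v0 v1 v2 s tl
    rw [withValue_eq, mem_prependIf, mem_prependIf]
    simp only [Nat.ble_eq]
    grind
  have h : x ∈ blockExponents w n f tl ↔
      (∃ v2 ≤ n, ∃ v0 ≤ n - v2, ∃ v1 ≤ n - v2 - v0, ∃ v4,
        (v4 = 4 * (w + 620 - (v0 + 2 * v1 + 4 * v2 + 8 * (n - v2 - v0 - v1))) % 31 ∨
          v4 = 4 * (w + 620 - (v0 + 2 * v1 + 4 * v2 + 8 * (n - v2 - v0 - v1))) % 31 + 31) ∧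
          v4 ≤ n - v2 - v0 - v1 ∧ f v0 v1 v2 (n - v2 - v0 - v1 - v4) v4 = x) ∨ x ∈ tl := by
    refine mem_prependUpTo (fun v2 => ?_) n tl
    refine mem_prependUpTo (fun v0 => ?_) (n - v2)
    refine mem_prependUpTo (fun v1 tl => ?_) (n - v2 - v0)
    rw [withValue_eq (Nat.sub (Nat.sub (Nat.sub n v2) v0) v1)]
    exact inner v0 v1 v2 (n - v2 - v0 - v1) tl
  refine Iff.trans h (or_congr_left ?_)
  clear h inner
  constructor
  · rintro ⟨v2, h2, v0, h0, v1, h1, v4, h4, h3, rfl⟩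
    refine ⟨v0, v1, v2, _, v4, ?_, ?_, rfl⟩ <;> omega
  · rintro ⟨v0, v1, v2, v3, v4, hs, hv, rfl⟩
    refine ⟨v2, by omega, v0, by omega, v1, by omega, v4, by omega, by omega, ?_⟩
    rw [show n - v2 - v0 - v1 - v4 = v3 by omega]

theorem map_prependUpTo {α β : Type} {f : ℕ → List α → List α} {f' : ℕ → List β → List β}
    {g : α → β} (h : ∀ i tl, (f i tl).map g = f' i (tl.map g)) (n : ℕ) (tl : List α) :
    (prependUpTo n f tl).map g = prependUpTo n f' (tl.map g) := by
  have key : ∀ n i, (Nat.rec (motive := fun _ => ℕ → List α) (fun i => f i tl)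
      (fun _ ih i => f i (ih (Nat.succ i))) n i).map g =
      Nat.rec (motive := fun _ => ℕ → List β) (fun i => f' i (tl.map g))
        (fun _ ih i => f' i (ih (Nat.succ i))) n i := by
    intro n
    induction n with
    | zero => exact fun i => h i tl
    | succ n ih => exact fun i => (h i _).trans (congrArg (f' i) (ih (i + 1)))
  exact key n 0

theorem map_prependIf {α β : Type} (g : α → β) (b : Bool) (a : α) (tl : List α) :
    (prependIf b a tl).map g = prependIf b (g a) (tl.map g) := by
  cases b <;> rfl

theorem map_blockExponents {α β : Type} (w n : ℕ) (f : ℕ → ℕ → ℕ → ℕ → ℕ → α) (g : α → β)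
    (tl : List α) : (blockExponents w n f tl).map g =
      blockExponents w n (fun v0 v1 v2 v3 v4 => g (f v0 v1 v2 v3 v4)) (tl.map g) := by
  refine map_prependUpTo (fun v2 => map_prependUpTo (fun v0 => map_prependUpTo (fun v1 tl => ?_) _)
    _) n tl
  simp only [withValue_eq, map_prependIf]

theorem distinctBits_cons (c : ℕ) (l : List ℕ) (m : ℕ) :
    distinctBits (c :: l) m = (!m.testBit c && distinctBits l (m ||| 1 <<< c)) := by
  change ifTrue (Nat.beq (m >>> c % 2) 0) (withValue (m ||| 1 <<< c) (distinctBits l)) false = _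
  rw [ifTrue_eq, withValue_eq, Nat.testBit_eq_decide_div_mod_eq, ← Nat.shiftRight_eq_div_pow]
  simp only [Nat.beq_eq]
  rcases Nat.mod_two_eq_zero_or_one (m >>> c) with h | h <;> simp [h]

theorem nodup_of_distinctBits {l : List ℕ} {m : ℕ} (h : distinctBits l m = true) :
    l.Nodup ∧ ∀ c ∈ l, m.testBit c = false := by
  induction l generalizing m with
  | nil => simp
  | cons c l ih =>
    rw [distinctBits_cons, Bool.and_eq_true, Bool.not_eq_true'] at h
    obtain ⟨hl, hm⟩ := ih h.2
    simp only [Nat.testBit_or, Nat.one_shiftLeft, Nat.testBit_two_pow, Bool.or_eq_false_iff,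
      decide_eq_false_iff_not] at hm
    refine ⟨List.nodup_cons.mpr ⟨fun hc => (hm c hc).2 rfl, hl⟩, ?_⟩
    intro d hd
    rcases List.mem_cons.mp hd with rfl | hd
    · exact h.1
    · exact (hm d hd).1

theorem weight_cycWeight (v : Fin 5 →₀ ℕ) : Finsupp.weight cycWeight v =
    ((v 0 + 2 * v 1 + 4 * v 2 + 8 * v 3 + 16 * v 4 : ℕ) : ZMod 31) := by
  rw [Finsupp.weight_apply, Finsupp.sum_fintype _ _ (fun i => zero_smul ℕ (cycWeight i)),
    Fin.sum_univ_five]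
  simp only [cycWeight, nsmul_eq_mul]
  push_cast
  norm_num
  ring

theorem weight_cycWeight_eq_iff (v : Fin 5 →₀ ℕ) {w : ℕ} (hw : w < 31) :
    Finsupp.weight cycWeight v = (w : ZMod 31) ↔
      (v 0 + 2 * v 1 + 4 * v 2 + 8 * v 3 + 16 * v 4) % 31 = w := by
  rw [weight_cycWeight, ZMod.natCast_eq_natCast_iff, Nat.ModEq, Nat.mod_eq_of_lt hw]

theorem degree_eq_sum_five (v : Fin 5 →₀ ℕ) : v.degree = v 0 + v 1 + v 2 + v 3 + v 4 := by
  rw [Finsupp.degree_eq_sum, Fin.sum_univ_five]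

theorem monomialCode_injOn {w : ℕ} (hw : w < 31) (h : blockCodesDistinct w = true) :
    Set.InjOn (fun v : Fin 5 →₀ ℕ => monomialCode (v 0) (v 1) (v 2) (v 3) (v 4))
      {v | v.degree = 31 ∧ Finsupp.weight cycWeight v = (w : ZMod 31)} := by
  have hmap := map_blockExponents w 31 (fun v0 v1 v2 v3 v4 => (v0, v1, v2, v3, v4))
    (fun t => monomialCode t.1 t.2.1 t.2.2.1 t.2.2.2.1 t.2.2.2.2) []
  have hnodup := (nodup_of_distinctBits h).1
  rw [show blockExponents w 31 monomialCode [] = _ from hmap.symm] at hnodup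
  have hmem : ∀ v : Fin 5 →₀ ℕ, v.degree = 31 → Finsupp.weight cycWeight v = (w : ZMod 31) →
      (v 0, v 1, v 2, v 3, v 4) ∈
        blockExponents w 31 (fun v0 v1 v2 v3 v4 => (v0, v1, v2, v3, v4)) [] := by
    intro v hv hv'
    rw [mem_blockExponents hw le_rfl]
    refine Or.inl ⟨_, _, _, _, _, ?_, (weight_cycWeight_eq_iff v hw).mp hv', rfl⟩
    rw [← degree_eq_sum_five, hv]
  rintro u ⟨hu, hu'⟩ v ⟨hv, hv'⟩ huv
  have := List.inj_on_of_nodup_map hnodup (hmem u hu hu') (hmem v hv hv') huv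
  simp only [Prod.mk.injEq] at this
  ext j
  fin_cases j
  · exact this.1
  · exact this.2.1
  · exact this.2.2.1
  · exact this.2.2.2.1
  · exact this.2.2.2.2

section
open MvPolynomial

theorem codeVec_eq_sum (f : P 5) (n : ℕ) : codeVec f n =
    ∑ v ∈ f.support, if monomialCode (v 0) (v 1) (v 2) (v 3) (v 4) = n then f.coeff v else 0 := by
  conv_lhs => rw [f.as_sum, map_sum, Finset.sum_apply]
  refine Finset.sum_congr rfl fun v _ => ?_
  have : monomial v (f.coeff v) = f.coeff v • monomial v (1 : ZMod 2) := by
    rw [smul_monomial, smul_eq_mul, mul_one]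
  rw [this, map_smul, Pi.smul_apply, codeVec_apply, codeHom_monomial, Polynomial.coeff_X_pow,
    smul_eq_mul]
  simp [eq_comm]

theorem degree_and_weight_of_mem_blockHit {n : ℕ} {w : ZMod 31} {f : P 5} (hf : f ∈ blockHit n w)
    {v : Fin 5 →₀ ℕ} (hv : f.coeff v ≠ 0) :
    v.degree = n ∧ Finsupp.weight cycWeight v = w := by
  have h1 := twistedHit_le_homogeneousSubmodule n (blockHit_le_twistedHit n w hf) hv
  refine ⟨?_, blockHit_le_weightedHomogeneousSubmodule n w hf hv⟩
  rw [← h1, Finsupp.degree_eq_weight_one]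
  rfl

/-- The substitution `y_j ↦ z^{c_j}` is injective on a block if the monomials of the block have
different codes. -/
theorem eq_zero_of_codeVec_eq_zero {w : ℕ} (hw : w < 31) (h : blockCodesDistinct w = true)
    {f : P 5} (hf : f ∈ blockHit 31 (w : ZMod 31)) (h0 : codeVec f = 0) : f = 0 := by
  by_contra hne
  obtain ⟨u, hu⟩ := MvPolynomial.ne_zero_iff.mp hne
  refine hu ?_
  have := codeVec_eq_sum f (monomialCode (u 0) (u 1) (u 2) (u 3) (u 4))
  rw [h0, Finset.sum_eq_single u, if_pos rfl] at this
  · exact this.symm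
  · intro v hv hvu
    rw [if_neg]
    exact fun he => hvu (monomialCode_injOn hw h
      (degree_and_weight_of_mem_blockHit hf (mem_support_iff.mp hv))
      (degree_and_weight_of_mem_blockHit hf hu) he)
  · intro hu'
    exact absurd (mem_support_iff.mpr hu) hu'

/-- The rows of a block span its image under the substitution `y_j ↦ z^{c_j}`. -/
theorem span_rowVec_blockRows {w : ℕ} (hw : w < 31) :
    Submodule.span (ZMod 2) (rowVec '' {r | r ∈ blockRows w}) =
      (blockHit 31 (w : ZMod 31)).map codeVec := by
  rw [blockHit, Submodule.map_span]
  congr 1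
  ext y
  have key : ∀ k n, k + n = 31 → ∀ x, (∃ v0 v1 v2 v3 v4, v0 + v1 + v2 + v3 + v4 = n ∧
        (v0 + 2 * v1 + 4 * v2 + 8 * v3 + 16 * v4) % 31 = w ∧ sqRow k v0 v1 v2 v3 v4 = x) ↔
      ∃ v : Fin 5 →₀ ℕ, v.degree = 31 - k ∧ Finsupp.weight cycWeight v = (w : ZMod 31) ∧
        sqRow k (v 0) (v 1) (v 2) (v 3) (v 4) = x := by
    intro k n hkn x
    constructor
    · rintro ⟨v0, v1, v2, v3, v4, h1, h2, rfl⟩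
      refine ⟨Finsupp.equivFunOnFinite.symm ![v0, v1, v2, v3, v4], ?_, ?_, rfl⟩
      · rw [degree_eq_sum_five]
        exact h1.trans (by omega)
      · rw [weight_cycWeight_eq_iff _ hw]
        exact h2
    · rintro ⟨v, h1, h2, rfl⟩
      refine ⟨_, _, _, _, _, ?_, (weight_cycWeight_eq_iff v hw).mp h2, rfl⟩
      rw [← degree_eq_sum_five, h1]
      omega
  have hrows : ∀ x, x ∈ blockRows w ↔ ∃ (i : ℕ) (v : Fin 5 →₀ ℕ), 2 ^ i ≤ 31 ∧
      v.degree = 31 - 2 ^ i ∧ Finsupp.weight cycWeight v = (w : ZMod 31) ∧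
        sqRow (2 ^ i) (v 0) (v 1) (v 2) (v 3) (v 4) = x := by
    intro x
    rw [blockRows, mem_blockExponents hw (by norm_num), mem_blockExponents hw (by norm_num),
      mem_blockExponents hw (by norm_num), mem_blockExponents hw (by norm_num),
      mem_blockExponents hw (by norm_num), key 1 30 rfl, key 2 29 rfl, key 4 27 rfl,
      key 8 23 rfl, key 16 15 rfl]
    constructor
    · rintro (⟨v, hv⟩ | ⟨v, hv⟩ | ⟨v, hv⟩ | ⟨v, hv⟩ | ⟨v, hv⟩ | hx)
      · exact ⟨0, v, by norm_num, hv⟩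
      · exact ⟨1, v, by norm_num, hv⟩
      · exact ⟨2, v, by norm_num, hv⟩
      · exact ⟨3, v, by norm_num, hv⟩
      · exact ⟨4, v, by norm_num, hv⟩
      · cases hx
    · rintro ⟨i, v, hi, hv⟩
      have : i < 5 := by
        by_contra! h5
        have := Nat.pow_le_pow_right (n := 2) (by norm_num) h5
        omega
      interval_cases i
      · exact Or.inl ⟨v, hv⟩
      · exact Or.inr (Or.inl ⟨v, hv⟩)
      · exact Or.inr (Or.inr (Or.inl ⟨v, hv⟩))
      · exact Or.inr (Or.inr (Or.inr (Or.inl ⟨v, hv⟩)))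
      · exact Or.inr (Or.inr (Or.inr (Or.inr (Or.inl ⟨v, hv⟩))))
  constructor
  · rintro ⟨x, hx, rfl⟩
    obtain ⟨i, v, h1, h2, h3, rfl⟩ := (hrows x).mp hx
    exact ⟨_, ⟨i, v, h1, h2, h3, rfl⟩, (rowVec_sqRow _ v).symm⟩
  · rintro ⟨_, ⟨i, v, h1, h2, h3, rfl⟩, rfl⟩
    have hx := (hrows (sqRow (2 ^ i) (v 0) (v 1) (v 2) (v 3) (v 4))).mpr
      ⟨i, v, h1, h2, h3, Eq.refl _⟩
    exact ⟨sqRow (2 ^ i) (v 0) (v 1) (v 2) (v 3) (v 4), hx,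
      rowVec_sqRow (2 ^ i) v⟩

theorem finrank_blockHit_eq_blockRank {w : ℕ} (hw : w < 31) (h : blockCodesDistinct w = true)
    (h0 : blockRank w ≠ 0) :
    Module.finrank (ZMod 2) (blockHit 31 (w : ZMod 31)) = blockRank w := by
  refine Eq.trans ?_ (eliminate_zero_eq_finrank h0).symm
  rw [span_rowVec_blockRows hw, ← LinearMap.range_domRestrict, LinearMap.finrank_range_of_inj]
  rw [← LinearMap.ker_eq_bot, LinearMap.ker_eq_bot']
  exact fun f hf => Subtype.ext (eq_zero_of_codeVec_eq_zero hw h f.2 hf)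

end

/-! ### The ranks of the blocks -/

theorem blockCodesDistinct_0 : blockCodesDistinct 0 = true := by decide +kernel

theorem blockRank_0 : blockRank 0 = 1664 := by decide +kernel

theorem blockCodesDistinct_1 : blockCodesDistinct 1 = true := by decide +kernel

theorem blockRank_1 : blockRank 1 = 1662 := by decide +kernel

theorem blockCodesDistinct_3 : blockCodesDistinct 3 = true := by decide +kernel

theorem blockRank_3 : blockRank 3 = 1661 := by decide +kernel

theorem blockCodesDistinct_5 : blockCodesDistinct 5 = true := by decide +kernel

theorem blockRank_5 : blockRank 5 = 1660 := by decide +kernel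

theorem blockCodesDistinct_7 : blockCodesDistinct 7 = true := by decide +kernel

theorem blockRank_7 : blockRank 7 = 1661 := by decide +kernel

theorem blockCodesDistinct_11 : blockCodesDistinct 11 = true := by decide +kernel

theorem blockRank_11 : blockRank 11 = 1660 := by decide +kernel

theorem blockCodesDistinct_15 : blockCodesDistinct 15 = true := by decide +kernel

theorem blockRank_15 : blockRank 15 = 1662 := by decide +kernel

theorem finrank_blockHit_of_blockRank {w r : ℕ} {w' : ZMod 31} (hw' : (w : ZMod 31) = w')
    (hw : w < 31) (hr : r ≠ 0) (h : blockCodesDistinct w = true) (hb : blockRank w = r) :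
    Module.finrank (ZMod 2) (blockHit 31 w') = r := by
  rw [← hw', finrank_blockHit_eq_blockRank hw h (by rwa [hb]), hb]

theorem finrank_hit_five_thirtyOne : Module.finrank (ZMod 2) (hit 5 31) = 51494 := by
  have h0 : Module.finrank (ZMod 2) (blockHit 31 0) = 1664 :=
    finrank_blockHit_of_blockRank (w := 0) (by norm_num) (by norm_num) (by norm_num)
      blockCodesDistinct_0 blockRank_0
  have h1 : Module.finrank (ZMod 2) (blockHit 31 1) = 1662 :=
    finrank_blockHit_of_blockRank (w := 1) (by norm_num) (by norm_num) (by norm_num)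
      blockCodesDistinct_1 blockRank_1
  have h3 : Module.finrank (ZMod 2) (blockHit 31 3) = 1661 :=
    finrank_blockHit_of_blockRank (w := 3) (by norm_num) (by norm_num) (by norm_num)
      blockCodesDistinct_3 blockRank_3
  have h5 : Module.finrank (ZMod 2) (blockHit 31 5) = 1660 :=
    finrank_blockHit_of_blockRank (w := 5) (by norm_num) (by norm_num) (by norm_num)
      blockCodesDistinct_5 blockRank_5
  have h7 : Module.finrank (ZMod 2) (blockHit 31 7) = 1661 :=
    finrank_blockHit_of_blockRank (w := 7) (by norm_num) (by norm_num) (by norm_num)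
      blockCodesDistinct_7 blockRank_7
  have h11 : Module.finrank (ZMod 2) (blockHit 31 11) = 1660 :=
    finrank_blockHit_of_blockRank (w := 11) (by norm_num) (by norm_num) (by norm_num)
      blockCodesDistinct_11 blockRank_11
  have h15 : Module.finrank (ZMod 2) (blockHit 31 15) = 1662 :=
    finrank_blockHit_of_blockRank (w := 15) (by norm_num) (by norm_num) (by norm_num)
      blockCodesDistinct_15 blockRank_15
  rw [finrank_hit_eq_cyc, finrank_twistedHit_eq_sum,
    sum_eq_of_two_mul_invariant (finrank_blockHit_two_mul 31), h0, h1, h3, h5, h7, h11, h15]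

theorem finrank_homogeneousSubmodule_five_thirtyOne :
    Module.finrank (ZMod 2) (MvPolynomial.homogeneousSubmodule (Fin 5) (ZMod 2) 31) = 52360 := by
  rw [finrank_homogeneousSubmodule]
  refine (Finset.card_finsuppAntidiag_nat_eq_choose 31).trans ?_
  rw [Finset.card_univ, Fintype.card_fin]
  rfl

end HitProblem

theorem mainTheorem1 :
    (HitProblem.admissibleMonomials 5 31).ncard = 866 ∧
      Module.finrank (ZMod 2) (HitProblem.Qdeg 5 31) = 866 := by
  have h1 := HitProblem.ncard_admissibleMonomials_add_finrank_hit 5 31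
  have h2 := HitProblem.finrank_Qdeg_add_finrank_hit 5 31
  rw [HitProblem.finrank_hit_five_thirtyOne,
    HitProblem.finrank_homogeneousSubmodule_five_thirtyOne] at h1 h2
  omega
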